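/- Let $K \subset \mathbb{N} = \{1,2,3,\dots\}$, put $\zeta_K(s) = \sum_{n \in K} n^{-s}$ for $\operatorname{Re} s > 1$ and $\pi_K(x) = \#\{n \in K : n \le x\}$. For a bounded symmetric interval $I = (-T,T)$, $0 < T < \infty$, and $g \in L^2(I)$ let $$\mathcal{Z}_{K,I}\, g(t) = \lim_{\delta \to 0^+} \frac{1}{\pi} \int_I g(\tau) \operatorname{Re} \zeta_K\bigl(1+\delta+\mathrm{i}(t-\tau)\bigr)\, d\tau, \qquad t \in I,$$ the limit being taken in $L^2(I)$; this limit exists for every $g \in L^2(I)$, and $\mathcal{Z}_{K,I}$ is a bounded linear operator on $L^2(I)$. Theorem 3 (identity theorem). Let $K \subset \mathbb{N}$ and $A \ge 0$. Then the operator $\mathcal{Z}_{K,I} - A\,\mathrm{Id}$ is compact on $L^2(I)$ for every bounded symmetric interval $I$ if and only if the limit $\lim_{x\to\infty} \pi_K(x)/x$ exists and equals $A$. -/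

import Mathlib

open Filter Topology MeasureTheory

noncomputable section

/-- The `K`-zeta function `ζ_K(s) = ∑_{n ∈ K, n ≥ 1} n^{-s}`, the L-series whose coefficients are
the indicator function of `K` (the index `0` never contributes to an L-series). -/
def kZeta (K : Set ℕ) (s : ℂ) : ℂ := LSeries (K.indicator 1) s

/-- The counting function `π_K(x) = #{n ∈ K : 1 ≤ n ≤ x}`. -/
def kCount (K : Set ℕ) (x : ℝ) : ℕ := {n : ℕ | n ∈ K ∧ 1 ≤ n ∧ (n : ℝ) ≤ x}.ncard

/-- The complex Hilbert space `L²(I)` for `I = (-T, T)`. -/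
abbrev L2Sym (T : ℝ) : Type := Lp ℂ 2 (volume.restrict (Set.Ioo (-T) T))

/-- The function `t ↦ π⁻¹ ∫_I g(τ) Re ζ_K(1 + δ + i(t - τ)) dτ`, where `I = (-T, T)`. -/
def kZetaIntegral (K : Set ℕ) (T δ : ℝ) (g : L2Sym T) (t : ℝ) : ℂ :=
  (1 / (Real.pi : ℂ)) * ∫ τ in Set.Ioo (-T) T,
    g τ * ((kZeta K (1 + (δ : ℂ) + Complex.I * ((t : ℂ) - (τ : ℂ)))).re : ℂ)

theorem kZeta_summable (K : Set ℕ) {s : ℂ} (hs : 1 < s.re) :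
    LSeriesSummable (K.indicator 1) s := by
  refine LSeriesSummable_of_bounded_of_one_lt_re (m := 1) (fun n _ => ?_) hs
  by_cases h : n ∈ K <;> simp [h]

theorem kZeta_abscissa (K : Set ℕ) :
    LSeries.abscissaOfAbsConv (K.indicator (1 : ℕ → ℂ)) ≤ 1 := by
  refine LSeries.abscissaOfAbsConv_le_of_forall_lt_LSeriesSummable (x := 1) (fun y hy => ?_)
  exact kZeta_summable K (by simpa using hy)

theorem kZeta_continuous (K : Set ℕ) {δ : ℝ} (hδ : 0 < δ) :
    Continuous (fun u : ℝ => kZeta K (1 + (δ : ℂ) + Complex.I * (u : ℂ))) := by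
  have h := (LSeries_differentiableOn (K.indicator (1 : ℕ → ℂ))).continuousOn
  refine h.comp_continuous (by fun_prop) (fun u => ?_)
  refine lt_of_le_of_lt (kZeta_abscissa K) ?_
  simp only [Complex.add_re, Complex.one_re, Complex.ofReal_re, Complex.mul_re, Complex.I_re,
    Complex.I_im, Complex.ofReal_im]
  have : (1 : ℝ) < 1 + δ + (0 * u - 1 * 0) := by linarith
  exact_mod_cast this

theorem kZeta_norm_le (K : Set ℕ) {δ : ℝ} (hδ : 0 < δ) (u : ℝ) :
    ‖kZeta K (1 + (δ : ℂ) + Complex.I * (u : ℂ))‖ ≤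
      ∑' n, ‖LSeries.term (K.indicator 1) (1 + (δ : ℂ)) n‖ := by
  have e : ∀ n, ‖LSeries.term (K.indicator 1) (1 + (δ : ℂ) + Complex.I * (u : ℂ)) n‖ =
      ‖LSeries.term (K.indicator 1) (1 + (δ : ℂ)) n‖ := by
    intro n
    simp [LSeries.norm_term_eq]
  have hs : LSeriesSummable (K.indicator 1) (1 + (δ : ℂ)) :=
    kZeta_summable K (by simpa using hδ)
  have hs' : Summable fun n =>
      ‖LSeries.term (K.indicator 1) (1 + (δ : ℂ) + Complex.I * (u : ℂ)) n‖ := by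
    simpa only [e] using hs.norm
  have := norm_tsum_le_tsum_norm hs'
  simpa only [e, kZeta, LSeries] using this

/-- For `δ > 0` the function `kZetaIntegral K T δ g` belongs to `L²(I)`. -/
theorem kZetaIntegral_memLp (K : Set ℕ) (T : ℝ) {δ : ℝ} (hδ : 0 < δ) (g : L2Sym T) :
    MemLp (kZetaIntegral K T δ g) 2 (volume.restrict (Set.Ioo (-T) T)) := by
  set μ := volume.restrict (Set.Ioo (-T) T) with hμ
  set C := ∑' n, ‖LSeries.term (K.indicator 1) (1 + (δ : ℂ)) n‖
  have hg : Integrable (fun τ => g τ) μ := (Lp.memLp g).integrable (by norm_num)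
  have hk : ∀ u : ℝ, ‖((kZeta K (1 + (δ : ℂ) + Complex.I * (u : ℂ))).re : ℂ)‖ ≤ C := by
    intro u
    rw [Complex.norm_real]
    exact (Complex.abs_re_le_norm _).trans (kZeta_norm_le K hδ u)
  have hc : Continuous
      (fun u : ℝ => ((kZeta K (1 + (δ : ℂ) + Complex.I * (u : ℂ))).re : ℂ)) :=
    Complex.continuous_ofReal.comp (Complex.continuous_re.comp (kZeta_continuous K hδ))
  have hb : ∀ t τ : ℝ, ‖g τ * ((kZeta K (1 + (δ : ℂ) +
      Complex.I * ((t : ℂ) - (τ : ℂ)))).re : ℂ)‖ ≤ ‖g τ‖ * C := by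
    intro t τ
    rw [norm_mul, ← Complex.ofReal_sub]
    exact mul_le_mul_of_nonneg_left (hk _) (norm_nonneg _)
  have hcont : Continuous (kZetaIntegral K T δ g) := by
    unfold kZetaIntegral
    refine continuous_const.mul ?_
    refine continuous_of_dominated (bound := fun τ => ‖g τ‖ * C) ?_ ?_ (hg.norm.mul_const C) ?_
    · intro t
      refine hg.aestronglyMeasurable.mul (Continuous.aestronglyMeasurable ?_)
      have := hc.comp (continuous_const.sub continuous_id : Continuous fun τ : ℝ => t - τ)
      simpa [Function.comp_def] using this
    · intro t
      exact Eventually.of_forall (hb t)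
    · refine Eventually.of_forall (fun τ => continuous_const.mul ?_)
      have := hc.comp (continuous_id.sub continuous_const : Continuous fun t : ℝ => t - τ)
      simpa [Function.comp_def] using this
  refine MemLp.of_bound hcont.aestronglyMeasurable
    (‖(1 / (Real.pi : ℂ))‖ * ∫ τ, ‖g τ‖ * C ∂μ) (Eventually.of_forall fun t => ?_)
  unfold kZetaIntegral
  rw [norm_mul]
  exact mul_le_mul_of_nonneg_left
    (norm_integral_le_of_norm_le (hg.norm.mul_const C) (Eventually.of_forall (hb t)))
    (norm_nonneg _)

/-- The element of `L²(I)` given by `kZetaIntegral K T δ g`; only `δ > 0` matters. -/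
def kZetaApprox (K : Set ℕ) (T δ : ℝ) (g : L2Sym T) : L2Sym T :=
  if hδ : 0 < δ then (kZetaIntegral_memLp K T hδ g).toLp (kZetaIntegral K T δ g) else 0

/-- `Z` is the operator `𝒵_{K,I}`, `I = (-T, T)`: for every `g ∈ L²(I)`, the functions
`π⁻¹ ∫_I g(τ) Re ζ_K(1 + δ + i(t - τ)) dτ` converge to `Z g` in `L²(I)` as `δ → 0⁺`. -/
def IsKZetaOperator (K : Set ℕ) (T : ℝ) (Z : L2Sym T →L[ℂ] L2Sym T) : Prop :=
  ∀ g : L2Sym T, Tendsto (fun δ : ℝ => kZetaApprox K T δ g) (𝓝[>] 0) (𝓝 (Z g))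

/-- There is at most one such operator. -/
theorem IsKZetaOperator.unique {K : Set ℕ} {T : ℝ} {Z Z' : L2Sym T →L[ℂ] L2Sym T}
    (h : IsKZetaOperator K T Z) (h' : IsKZetaOperator K T Z') : Z = Z' :=
  ContinuousLinearMap.ext fun g => tendsto_nhds_unique (h g) (h' g)

open Classical in
/-- The bounded operator `𝒵_{K,I}` on `L²(I)`, `I = (-T, T)` (the value `0` is a default in case
the limit does not define a bounded operator). -/
def kZetaOperator (K : Set ℕ) (T : ℝ) : L2Sym T →L[ℂ] L2Sym T :=
  if h : ∃ Z : L2Sym T →L[ℂ] L2Sym T, IsKZetaOperator K T Z then h.choose else 0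

end

/-! Splitting cosines into exponentials turns `π⁻¹ Re ζ_K(1 + δ + iu)` into a sum over the
frequencies `± log n`, `n ∈ K`, with coefficients `n^{-1-δ} / 2π`. Before the limit the operator is
therefore `V* D_δ V`, where `V` is the analysis operator of the exponentials of frequency `± log n`
with weight `1/n`, and `D_δ` multiplies by `n^{-δ}`. Windows of fixed length carry bounded weight,
so `V` is bounded. Since `D_δ` tends strongly to the identity on the range of `V`, the limit is the
frame operator `V* V` (`kZetaOperator_eq`).

Density implies compactness: move each frequency to a neighbouring point of `hℤ`, `h = π/(Tm)`. The
exponentials on `hℤ` form a Parseval frame of `L²(-T,T)` after normalization, so the moved operator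
minus `A` is a frame multiplier whose symbol is (weight of the node)/`h - A`. Partial summation
shows that density `A` sends this symbol to zero, hence the multiplier is compact
(`isCompactOperator_node_sub`). Moving the frequencies changes `V` by `O(√h)` in norm
(`isBessel_weightedExp_sub_node`), and compact operators are closed in norm. This works for each `T`
separately.

Compactness implies density: the exponentials `e^{ixt}` are bounded and tend weakly to zero as `x →
∞`, so a compact `Z - A` forces the normalized quadratic form of `Z` at `e^{ixt}` to tend to `A`.
That form is the Fejér average of the weights around `x` (`hasSum_fejerAverage`). Convolving further
with `e^{-v}` on `[0, ∞)` gives the Fejér average of `b(x) = π_K(e^x)/e^x + O(e^{-x})`. As `b` falls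
at most exponentially and the Fejér kernels concentrate as `T → ∞`, a Tauberian argument recovers `b
→ A` (`tendsto_of_tendsto_fejerAverage`). Here the hypothesis is needed for arbitrarily large `T`.
-/

/-! ### Bessel families, their analysis operators and frame multipliers. -/

section Bessel

variable {ι H : Type*} [NormedAddCommGroup H] [InnerProductSpace ℂ H]

/-- The family `v` satisfies the Bessel inequality with bound `B`. -/
def IsBessel (v : ι → H) (B : ℝ) : Prop :=
  ∀ (g : H) (s : Finset ι), ∑ i ∈ s, ‖inner ℂ (v i) g‖ ^ 2 ≤ B * ‖g‖ ^ 2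

theorem IsBessel.memℓp {v : ι → H} {B : ℝ} (hv : IsBessel v B) (g : H) :
    Memℓp (fun i => inner ℂ (v i) g) 2 := by
  refine memℓp_gen' (C := B * ‖g‖ ^ 2) fun s => ?_
  simpa using hv g s

/-- The analysis operator `g ↦ (⟪v i, g⟫)ᵢ` of a Bessel family. -/
noncomputable def IsBessel.analysis {v : ι → H} {B : ℝ} (hv : IsBessel v B) :
    H →L[ℂ] lp (fun _ : ι => ℂ) 2 :=
  LinearMap.mkContinuous
    { toFun := fun g => ⟨fun i => inner ℂ (v i) g, hv.memℓp g⟩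
      map_add' := fun f g => by ext i; exact inner_add_right _ _ _
      map_smul' := fun c g => by ext i; exact inner_smul_right _ _ _ }
    (√B) fun g => by
      refine lp.norm_le_of_forall_sum_le (by norm_num) (by positivity) fun s => ?_
      have h := hv g s
      have h0 : 0 ≤ B * ‖g‖ ^ 2 := le_trans (Finset.sum_nonneg fun _ _ => by positivity) h
      have e : (√B * ‖g‖) ^ 2 = B * ‖g‖ ^ 2 := by
        rw [← Real.sqrt_sq (norm_nonneg g), ← Real.sqrt_mul' _ (sq_nonneg _), Real.sq_sqrt h0,
          Real.sqrt_sq (norm_nonneg g)]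
      simpa [e] using h

@[simp]
theorem IsBessel.analysis_apply {v : ι → H} {B : ℝ} (hv : IsBessel v B) (g : H) (i : ι) :
    hv.analysis g i = inner ℂ (v i) g := rfl

theorem IsBessel.norm_analysis_le {v : ι → H} {B : ℝ} (hv : IsBessel v B) :
    ‖hv.analysis‖ ≤ √B :=
  LinearMap.mkContinuous_norm_le _ (Real.sqrt_nonneg _) _

theorem IsBessel.hasSum_norm_sq {v : ι → H} {B : ℝ} (hv : IsBessel v B) (g : H) :
    HasSum (fun i => ‖inner ℂ (v i) g‖ ^ 2) (‖hv.analysis g‖ ^ 2) := by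
  have := lp.hasSum_norm (by norm_num) (hv.analysis g)
  simpa using this

theorem IsBessel.sub {v w : ι → H} {B C : ℝ} (hv : IsBessel v B) (hw : IsBessel w C) :
    IsBessel (fun i => v i - w i) (2 * (B + C)) := by
  intro g s
  calc ∑ i ∈ s, ‖inner ℂ (v i - w i) g‖ ^ 2
      ≤ ∑ i ∈ s, (2 * ‖inner ℂ (v i) g‖ ^ 2 + 2 * ‖inner ℂ (w i) g‖ ^ 2) := by
        refine Finset.sum_le_sum fun i _ => ?_
        rw [inner_sub_left]
        have := norm_sub_le (inner ℂ (v i) g) (inner ℂ (w i) g)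
        nlinarith [norm_nonneg (inner ℂ (v i) g - inner ℂ (w i) g),
          sq_nonneg (‖inner ℂ (v i) g‖ - ‖inner ℂ (w i) g‖)]
    _ ≤ _ := by
        rw [Finset.sum_add_distrib, ← Finset.mul_sum, ← Finset.mul_sum]
        linarith [hv g s, hw g s]

theorem IsBessel.neg {v : ι → H} {B : ℝ} (hv : IsBessel v B) : IsBessel (fun i => -v i) B := by
  intro g s
  simpa using hv g s

theorem IsBessel.smul {v : ι → H} {B : ℝ} (hv : IsBessel v B) {c : ι → ℂ} {M : ℝ}
    (hc : ∀ i, ‖c i‖ ≤ M) : IsBessel (fun i => c i • v i) (M ^ 2 * B) := by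
  intro g s
  calc ∑ i ∈ s, ‖inner ℂ (c i • v i) g‖ ^ 2
      ≤ ∑ i ∈ s, M ^ 2 * ‖inner ℂ (v i) g‖ ^ 2 := by
        refine Finset.sum_le_sum fun i _ => ?_
        rw [inner_smul_left, norm_mul, RCLike.norm_conj, mul_pow]
        gcongr
        exact hc i
    _ ≤ _ := by
        rw [← Finset.mul_sum, mul_assoc]
        exact mul_le_mul_of_nonneg_left (hv g s) (sq_nonneg M)

theorem IsBessel.analysis_sub {v w : ι → H} {B C D : ℝ} (hv : IsBessel v B) (hw : IsBessel w C)
    (hr : IsBessel (fun i => v i - w i) D) : hw.analysis = hv.analysis - hr.analysis := by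
  ext g i
  simp

variable [CompleteSpace H]

/-- This weak expansion is the tool for comparing operators `V* W`: two of them agree once their
scalar series agree termwise or after regrouping. -/
theorem IsBessel.hasSum_inner {v w : ι → H} {B C : ℝ} (hv : IsBessel v B) (hw : IsBessel w C)
    (f g : H) :
    HasSum (fun i => inner ℂ f (v i) * inner ℂ (w i) g)
      (inner ℂ f (hv.analysis.adjoint (hw.analysis g))) := by
  rw [ContinuousLinearMap.adjoint_inner_right]
  have := lp.hasSum_inner (𝕜 := ℂ) (hv.analysis f) (hw.analysis g)
  simpa [mul_comm] using this

/-- A Bessel family whose analysis operator is isometric is a Parseval frame. -/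
theorem IsBessel.adjoint_analysis_comp_self {v : ι → H} {B : ℝ} (hv : IsBessel v B)
    (h : ∀ g, HasSum (fun i => ‖inner ℂ (v i) g‖ ^ 2) (‖g‖ ^ 2)) (g : H) :
    hv.analysis.adjoint (hv.analysis g) = g := by
  have h1 : ∀ x, ‖hv.analysis x‖ = ‖x‖ := fun x => by
    have := (hv.hasSum_norm_sq x).unique (h x)
    exact (pow_left_inj₀ (norm_nonneg _) (norm_nonneg _) two_ne_zero).1 this
  exact DFunLike.congr_fun ((hv.analysis.norm_map_iff_adjoint_comp_self).1 h1) g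

/-- Controls the frame operator when the family is perturbed: `R` is the analysis operator of the
difference of the two families. -/
theorem norm_adjoint_comp_self_sub_le {K : Type*} [NormedAddCommGroup K] [InnerProductSpace ℂ K]
    [CompleteSpace K] (V R : H →L[ℂ] K) :
    ‖V.adjoint ∘L V - (V - R).adjoint ∘L (V - R)‖ ≤ 2 * ‖V‖ * ‖R‖ + ‖R‖ ^ 2 := by
  have e : V.adjoint ∘L V - (V - R).adjoint ∘L (V - R) =
      V.adjoint ∘L R + R.adjoint ∘L V - R.adjoint ∘L R := by
    ext x
    simp only [map_sub, sub_apply, ContinuousLinearMap.comp_apply,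
      add_apply]
    abel
  rw [e]
  have n (P Q : H →L[ℂ] K) : ‖P.adjoint ∘L Q‖ ≤ ‖P‖ * ‖Q‖ := by
    simpa using P.adjoint.opNorm_comp_le Q
  calc _ ≤ ‖V.adjoint ∘L R‖ + ‖R.adjoint ∘L V‖ + ‖R.adjoint ∘L R‖ :=
        (norm_sub_le _ _).trans (by gcongr; exact norm_add_le _ _)
    _ ≤ ‖V‖ * ‖R‖ + ‖R‖ * ‖V‖ + ‖R‖ * ‖R‖ := by gcongr <;> apply n
    _ = _ := by ring

omit [CompleteSpace H] in
theorem isCompactOperator_rankOne (x y : H) :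
    IsCompactOperator ((innerSL ℂ x).smulRight y : H →L[ℂ] H) :=
  (isCompactOperator_of_locallyCompactSpace_dom (innerSL ℂ x)).clm_comp
    (ContinuousLinearMap.toSpanSingleton ℂ y)

omit [CompleteSpace H] in
theorem isCompactOperator_finset_sum {ι : Type*} (s : Finset ι) (S : ι → H →L[ℂ] H)
    (h : ∀ i ∈ s, IsCompactOperator (S i)) : IsCompactOperator (∑ i ∈ s, S i : H →L[ℂ] H) :=
  Submodule.sum_mem (compactOperator (RingHom.id ℂ) H H) h

/-- A frame multiplier whose symbol tends to zero is compact. -/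
theorem IsBessel.isCompactOperator_multiplier {v : ι → H} {B D : ℝ} (hv : IsBessel v B)
    {c : ι → ℂ} (hw : IsBessel (fun i => c i • v i) D) (hc : Tendsto c cofinite (𝓝 0)) :
    IsCompactOperator (hv.analysis.adjoint ∘L hw.analysis) := by
  classical
  have hfin : ∀ n : ℕ, {i | ¬ ‖c i‖ < 1 / ((n : ℝ) + 1)}.Finite := fun n => by
    have := (tendsto_zero_iff_norm_tendsto_zero.1 hc).eventually_lt_const
      (show (0 : ℝ) < 1 / ((n : ℝ) + 1) by positivity)
    simpa [Filter.eventually_cofinite] using this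
  -- Finite-rank truncations: keep the finitely many indices whose symbol has size at least
  -- `1/(n+1)`.
  let S : ℕ → H →L[ℂ] H := fun n =>
    ∑ i ∈ (hfin n).toFinset, (innerSL ℂ (c i • v i)).smulRight (v i)
  refine isCompactOperator_of_tendsto (l := atTop) (F := S) ?_
    (Eventually.of_forall fun n => isCompactOperator_finset_sum _ _ fun i _ =>
      isCompactOperator_rankOne _ _)
  rw [tendsto_iff_norm_sub_tendsto_zero]
  have hbd : ∀ n, ‖S n - hv.analysis.adjoint ∘L hw.analysis‖ ≤
      √B * √((1 / ((n : ℝ) + 1)) ^ 2 * B) := by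
    intro n
    -- The remainder is again a multiplier, with symbol `d` bounded by `1/(n+1)`, so its norm is at
    -- most `B/(n+1)` up to the form of the square roots.
    let d : ι → ℂ := fun i => if ‖c i‖ < 1 / ((n : ℝ) + 1) then c i else 0
    have hd : ∀ i, ‖d i‖ ≤ 1 / ((n : ℝ) + 1) := fun i => by
      by_cases h : ‖c i‖ < 1 / ((n : ℝ) + 1)
      · simpa only [d, if_pos h] using h.le
      · simp only [d, if_neg h, norm_zero]; positivity
    have hdB := hv.smul hd
    have e : hv.analysis.adjoint ∘L hw.analysis - S n = hv.analysis.adjoint ∘L hdB.analysis := by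
      ext g
      refine ext_inner_left ℂ fun f => ?_
      have h1 := hv.hasSum_inner hw f g
      have h2 := hv.hasSum_inner hdB f g
      have h3 : HasSum (fun i => if i ∈ (hfin n).toFinset then
          inner ℂ f (v i) * inner ℂ (c i • v i) g else 0) (inner ℂ f (S n g)) := by
        have := hasSum_sum_of_ne_finset_zero (L := .unconditional ι) (s := (hfin n).toFinset)
          (f := fun i => if i ∈ (hfin n).toFinset then
            inner ℂ f (v i) * inner ℂ (c i • v i) g else 0) (fun i hi => by simp only [if_neg hi])
        convert this using 1
        simp only [S, sum_apply, inner_sum]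
        refine Finset.sum_congr rfl fun i hi => ?_
        rw [if_pos hi]
        simp [inner_smul_right, mul_comm]
      simp only [sub_apply, ContinuousLinearMap.comp_apply, inner_sub_right]
      have key : ∀ i, (inner ℂ f (v i) * inner ℂ (c i • v i) g - if i ∈ (hfin n).toFinset then
          inner ℂ f (v i) * inner ℂ (c i • v i) g else 0) =
            inner ℂ f (v i) * inner ℂ (d i • v i) g := fun i => by
        by_cases h : ‖c i‖ < 1 / ((n : ℝ) + 1)
        · have : i ∉ (hfin n).toFinset := by simpa using h
          simp only [if_neg this, d, if_pos h, sub_zero]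
        · have : i ∈ (hfin n).toFinset := by simpa using h
          simp only [if_pos this, d, if_neg h, sub_self, zero_smul, inner_zero_left, mul_zero]
      refine (h1.sub h3).unique ?_
      simp only [key]
      exact h2
    rw [norm_sub_rev, e]
    refine (hv.analysis.adjoint.opNorm_comp_le _).trans ?_
    rw [LinearIsometryEquiv.norm_map]
    gcongr
    · exact hv.norm_analysis_le
    · exact hdB.norm_analysis_le
  refine squeeze_zero (fun _ => norm_nonneg _) hbd ?_
  have h0 : Tendsto (fun n : ℕ => 1 / ((n : ℝ) + 1)) atTop (𝓝 0) :=
    tendsto_one_div_add_atTop_nhds_zero_nat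
  have : Tendsto (fun n : ℕ => √B * √((1 / ((n : ℝ) + 1)) ^ 2 * B)) atTop
      (𝓝 (√B * √(0 ^ 2 * B))) :=
    ((Real.continuous_sqrt.tendsto _).comp ((h0.pow 2).mul_const B)).const_mul _
  simpa using this

end Bessel

/-! ### The Fourier transform of functions on a bounded interval: Parseval on lattices and local
oscillation. -/

section FourierOn

/-- The Fourier transform `∫_{-T}^{T} g(τ) e^{-iξτ} dτ` of the restriction of `g` to `(-T, T)`. -/
noncomputable def fourierOn (T : ℝ) (g : ℝ → ℂ) (ξ : ℝ) : ℂ :=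
  ∫ τ in Set.Ioo (-T) T, g τ * Complex.exp (-(Complex.I * ξ * τ))

theorem norm_exp_neg_I_mul (ξ τ : ℝ) : ‖Complex.exp (-(Complex.I * ξ * τ))‖ = 1 := by
  rw [Complex.norm_exp]; simp

theorem memLp_exp (T ξ : ℝ) : MemLp (fun t : ℝ => Complex.exp (Complex.I * ξ * t)) 2
    (volume.restrict (Set.Ioo (-T) T)) := by
  refine MemLp.of_bound (Continuous.aestronglyMeasurable (by fun_prop)) 1
    (Eventually.of_forall fun t => ?_)
  rw [Complex.norm_exp]; simp

/-- The exponential `t ↦ e^{iξt}` as an element of `L²(-T, T)`. -/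
noncomputable def expL2 (T ξ : ℝ) : L2Sym T := (memLp_exp T ξ).toLp _

theorem inner_expL2 (T ξ : ℝ) (g : L2Sym T) : inner ℂ (expL2 T ξ) g = fourierOn T g ξ := by
  rw [L2.inner_def, fourierOn]
  refine integral_congr_ae ?_
  filter_upwards [(memLp_exp T ξ).coeFn_toLp] with t ht
  rw [expL2, ht, RCLike.inner_apply, ← Complex.exp_conj]
  simp

/-- Extend `g` by zero to `(-Tm, Tm)`: up to the factor `2Tm` the values at `jh` are its Fourier
coefficients there, and Parseval applies. The integer `m` allows arbitrarily fine lattices. -/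
theorem hasSum_norm_sq_fourierOn {T : ℝ} (hT : 0 < T) {m : ℕ} (hm : m ≠ 0) {g : ℝ → ℂ}
    (hg : MemLp g 2 (volume.restrict (Set.Ioo (-T) T))) {h : ℝ} (hh : h = Real.pi / (T * m)) :
    HasSum (fun j : ℤ => ‖fourierOn T g (j * h)‖ ^ 2)
      (2 * Real.pi / h * ∫ t in Set.Ioo (-T) T, ‖g t‖ ^ 2) := by
  have hm' : (1 : ℝ) ≤ m := by exact_mod_cast Nat.one_le_iff_ne_zero.2 hm
  have hTm : 0 < T * m := by positivity
  have hTle : T ≤ T * m := le_mul_of_one_le_right hT.le hm'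
  have hab : -(T * m) < T * m := by linarith
  set f : ℝ → ℂ := (Set.Ioo (-T) T).indicator g with hf
  have hsub : Set.Ioo (-T) T ⊆ Set.Ioc (-(T * m)) (T * m) := fun x hx =>
    ⟨by linarith [hx.1], by linarith [hx.2]⟩
  have hfL : MemLp f 2 (volume.restrict (Set.Ioc (-(T * m)) (T * m))) := by
    rw [hf, memLp_indicator_iff_restrict measurableSet_Ioo, Measure.restrict_restrict
      measurableSet_Ioo, Set.inter_eq_left.2 hsub]
    exact hg
  have hP := hasSum_sq_fourierCoeffOn hab hfL
  -- Stated for any integrand vanishing where `f` does, since it serves both the Fourier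
  -- coefficients and the squared norm.
  have hset {E : Type} [NormedAddCommGroup E] [NormedSpace ℝ E] (F : ℝ → ℂ → E)
      (hF : ∀ x, F x 0 = 0) : ∫ x in (-(T * m))..(T * m), F x (f x) =
      ∫ x in Set.Ioo (-T) T, F x (g x) := by
    rw [intervalIntegral.integral_of_le hab.le]
    have : (fun x => F x (f x)) = (Set.Ioo (-T) T).indicator fun x => F x (g x) := by
      ext x
      by_cases hx : x ∈ Set.Ioo (-T) T <;> simp [hf, hx, hF]
    rw [this, setIntegral_indicator measurableSet_Ioo, Set.inter_eq_right.2 hsub]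
  have hpi := Real.pi_pos
  have hcoef : ∀ j : ℤ, fourierCoeffOn hab f j = ((1 / (2 * (T * m)) : ℝ) : ℂ) *
      fourierOn T g (j * h) := by
    intro j
    rw [fourierCoeffOn_eq_integral, hset (fun x z => fourier (-j) (x : AddCircle _) • z) (by simp),
      fourierOn, show T * m - -(T * m) = 2 * (T * m) by ring, Complex.real_smul]
    congr 1
    refine setIntegral_congr_fun measurableSet_Ioo fun x _ => ?_
    simp only [fourier_coe_apply, smul_eq_mul]
    rw [mul_comm]
    congr 2
    rw [hh]
    have : (T : ℂ) * m ≠ 0 := by exact_mod_cast hTm.ne'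
    have h3 : (T : ℂ) ≠ 0 := by exact_mod_cast hT.ne'
    have h4 : (m : ℂ) ≠ 0 := by exact_mod_cast hm
    push_cast
    field_simp
  rw [hset (fun _ z => ‖z‖ ^ 2) (by simp)] at hP
  have := hP.mul_left ((2 * (T * m)) ^ 2)
  have e1 : ∀ j : ℤ, (2 * (T * m)) ^ 2 * ‖fourierCoeffOn hab f j‖ ^ 2 =
      ‖fourierOn T g (j * h)‖ ^ 2 := fun j => by
    rw [hcoef, norm_mul, Complex.norm_real, Real.norm_of_nonneg (by positivity)]
    field_simp
  have e2 : (2 * (T * m)) ^ 2 * (T * m - -(T * m))⁻¹ • ∫ x in Set.Ioo (-T) T, ‖g x‖ ^ 2 =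
      2 * Real.pi / h * ∫ t in Set.Ioo (-T) T, ‖g t‖ ^ 2 := by
    rw [hh, smul_eq_mul]
    field_simp
    ring
  simp only [e1, e2] at this
  exact this

theorem fourierOn_add (T : ℝ) (g : ℝ → ℂ) (a u : ℝ) :
    fourierOn T g (a + u) =
      fourierOn T (fun τ => g τ * Complex.exp (-(Complex.I * u * τ))) a := by
  unfold fourierOn
  refine integral_congr_ae (Eventually.of_forall fun τ => ?_)
  simp only [mul_assoc, ← Complex.exp_add]
  push_cast
  ring_nf

/-- Shifting the lattice amounts to modulating `g`, which does not change `‖g‖`; hence the sum does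
not depend on `u`. -/
theorem hasSum_norm_sq_fourierOn_add {T : ℝ} (hT : 0 < T) {m : ℕ} (hm : m ≠ 0) {g : ℝ → ℂ}
    (hg : MemLp g 2 (volume.restrict (Set.Ioo (-T) T))) {h : ℝ} (hh : h = Real.pi / (T * m))
    (u : ℝ) :
    HasSum (fun j : ℤ => ‖fourierOn T g (j * h + u)‖ ^ 2)
      (2 * Real.pi / h * ∫ t in Set.Ioo (-T) T, ‖g t‖ ^ 2) := by
  simp only [fourierOn_add]
  have hn : ∀ τ : ℝ, ‖g τ * Complex.exp (-(Complex.I * u * τ))‖ = ‖g τ‖ := fun τ => by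
    rw [norm_mul, norm_exp_neg_I_mul, mul_one]
  have hg' : MemLp (fun τ : ℝ => g τ * Complex.exp (-(Complex.I * u * τ))) 2
      (volume.restrict (Set.Ioo (-T) T)) :=
    hg.of_le (hg.1.mul (Continuous.aestronglyMeasurable (by fun_prop)))
      (Eventually.of_forall fun τ => (hn τ).le)
  simpa only [hn] using hasSum_norm_sq_fourierOn hT hm hg' hh

theorem hasDerivAt_fourierOn {T : ℝ} {g : ℝ → ℂ}
    (hg : Integrable g (volume.restrict (Set.Ioo (-T) T))) (ξ : ℝ) :
    HasDerivAt (fourierOn T g) (fourierOn T (fun τ => -Complex.I * τ * g τ) ξ) ξ := by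
  unfold fourierOn
  refine (hasDerivAt_integral_of_dominated_loc_of_deriv_le (bound := fun τ => |T| * ‖g τ‖)
    (s := Set.univ) (F := fun (ξ τ : ℝ) => g τ * Complex.exp (-(Complex.I * ξ * τ)))
    (F' := fun (ξ τ : ℝ) => -Complex.I * τ * g τ * Complex.exp (-(Complex.I * ξ * τ)))
    univ_mem ?_ ?_ ?_ ?_ (hg.norm.const_mul _) ?_).2
  · exact Eventually.of_forall fun x =>
      hg.1.mul (Continuous.aestronglyMeasurable (by fun_prop))
  · exact hg.mono (hg.1.mul (Continuous.aestronglyMeasurable (by fun_prop)))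
      (Eventually.of_forall fun τ => by rw [norm_mul, norm_exp_neg_I_mul, mul_one])
  · exact ((Continuous.aestronglyMeasurable (by fun_prop)).mul hg.1).mul
      (Continuous.aestronglyMeasurable (by fun_prop))
  · filter_upwards [ae_restrict_mem measurableSet_Ioo] with τ hτ x _
    rw [norm_mul, norm_exp_neg_I_mul, mul_one, norm_mul, norm_mul, norm_neg, Complex.norm_I,
      one_mul, Complex.norm_real]
    gcongr
    rw [Real.norm_eq_abs]
    exact (abs_lt.2 hτ).le.trans (le_abs_self T)
  · refine Eventually.of_forall fun τ x _ => ?_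
    have h1 : HasDerivAt (fun x : ℝ => -(Complex.I * (x : ℂ) * (τ : ℂ))) (-(Complex.I * τ)) x := by
      have := ((Complex.ofRealCLM.hasDerivAt (x := x)).const_mul Complex.I).mul_const (τ : ℂ)
      simpa using this.fun_neg
    exact (h1.cexp.const_mul (g τ)).congr_deriv (by ring)

/-- Cauchy–Schwarz, obtained from the nonnegativity of the variance of `f`. -/
theorem sq_integral_le {a b : ℝ} (hab : a < b) {f : ℝ → ℝ} (hf : Continuous f) :
    (∫ x in a..b, f x) ^ 2 ≤ (b - a) * ∫ x in a..b, f x ^ 2 := by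
  set c := (∫ x in a..b, f x) / (b - a)
  have hba : 0 < b - a := sub_pos.2 hab
  have h : 0 ≤ ∫ x in a..b, (f x - c) ^ 2 :=
    intervalIntegral.integral_nonneg hab.le fun _ _ => sq_nonneg _
  have e : ∫ x in a..b, (f x - c) ^ 2 =
      (∫ x in a..b, f x ^ 2) - 2 * c * (∫ x in a..b, f x) + c ^ 2 * (b - a) := by
    have : (fun x => (f x - c) ^ 2) = fun x => f x ^ 2 - 2 * c * f x + c ^ 2 := by
      ext x; ring
    rw [this, intervalIntegral.integral_add, intervalIntegral.integral_sub,
      intervalIntegral.integral_const_mul, intervalIntegral.integral_const, smul_eq_mul]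
    · ring
    all_goals exact Continuous.intervalIntegrable (by fun_prop) _ _
  rw [e] at h
  have hc : c * (b - a) = ∫ x in a..b, f x := div_mul_cancel₀ _ hba.ne'
  rw [← hc] at h ⊢
  have : c ^ 2 * (b - a) ≤ ∫ x in a..b, f x ^ 2 := by nlinarith
  nlinarith

/-- The right side is an integral over a window that does not depend on `x`, so all points attached
to the same node `a` share one bound. -/
theorem norm_sub_sq_le_integral {E : Type*} [NormedAddCommGroup E] [NormedSpace ℝ E]
    [CompleteSpace E] {F F' : ℝ → E}
    (hF : ∀ x, HasDerivAt F (F' x) x) (hF' : Continuous F') {a x h : ℝ} (hh : 0 < h)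
    (hx : |x - a| ≤ h) :
    ‖F x - F a‖ ^ 2 ≤ 2 * h * ∫ u in (-h)..h, ‖F' (a + u)‖ ^ 2 := by
  have hcn : Continuous fun u => ‖F' u‖ := hF'.norm
  have h1 : ‖F x - F a‖ ≤ ∫ u in (-h)..h, ‖F' (a + u)‖ := by
    rw [← intervalIntegral.integral_eq_sub_of_hasDerivAt (fun y _ => hF y)
      (hF'.intervalIntegrable a x), intervalIntegral.integral_comp_add_left (fun u => ‖F' u‖)]
    refine intervalIntegral.norm_integral_le_abs_integral_norm.trans ?_
    rw [intervalIntegral.abs_intervalIntegral_eq, intervalIntegral.integral_of_le (by linarith),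
      abs_of_nonneg (integral_nonneg fun _ => norm_nonneg _)]
    refine setIntegral_mono_set ((hcn.integrableOn_Ioc))
      (Eventually.of_forall fun _ => norm_nonneg _) (LE.le.eventuallyLE ?_)
    rw [abs_le] at hx
    intro y hy
    rw [Set.uIoc, Set.mem_Ioc] at hy
    constructor
    · rcases le_total a x with hax | hax
      · rw [min_eq_left hax] at hy; linarith
      · rw [min_eq_right hax] at hy; linarith
    · rcases le_total a x with hax | hax
      · rw [max_eq_right hax] at hy; linarith
      · rw [max_eq_left hax] at hy; linarith
  calc ‖F x - F a‖ ^ 2 ≤ (∫ u in (-h)..h, ‖F' (a + u)‖) ^ 2 := by gcongr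
    _ ≤ (h - -h) * ∫ u in (-h)..h, ‖F' (a + u)‖ ^ 2 :=
        sq_integral_le (by linarith) (by fun_prop)
    _ = _ := by ring

theorem continuous_fourierOn {T : ℝ} {g : ℝ → ℂ}
    (hg : Integrable g (volume.restrict (Set.Ioo (-T) T))) : Continuous (fourierOn T g) :=
  continuous_iff_continuousAt.2 fun ξ => (hasDerivAt_fourierOn hg ξ).continuousAt

theorem memLp_neg_I_mul {T : ℝ} {g : ℝ → ℂ}
    (hg : MemLp g 2 (volume.restrict (Set.Ioo (-T) T))) :
    MemLp (fun τ : ℝ => -Complex.I * τ * g τ) 2 (volume.restrict (Set.Ioo (-T) T)) := by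
  refine (hg.const_mul (T : ℂ)).of_le ((Continuous.aestronglyMeasurable (by fun_prop)).mul hg.1) ?_
  filter_upwards [ae_restrict_mem measurableSet_Ioo] with τ hτ
  rw [norm_mul, norm_mul, norm_neg, Complex.norm_I, one_mul, Complex.norm_real, norm_mul,
    Complex.norm_real]
  gcongr
  rw [Real.norm_eq_abs, Real.norm_eq_abs]
  exact (abs_lt.2 hτ).le.trans (le_abs_self T)

theorem integral_neg_I_mul_sq_le {T : ℝ} {g : ℝ → ℂ}
    (hg : MemLp g 2 (volume.restrict (Set.Ioo (-T) T))) :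
    ∫ t in Set.Ioo (-T) T, ‖-Complex.I * t * g t‖ ^ 2 ≤
      T ^ 2 * ∫ t in Set.Ioo (-T) T, ‖g t‖ ^ 2 := by
  rw [← integral_const_mul]
  refine integral_mono_ae (memLp_neg_I_mul hg).integrable_norm_pow'
    (hg.integrable_norm_pow'.const_mul _) ?_
  filter_upwards [ae_restrict_mem measurableSet_Ioo] with τ hτ
  simp only [norm_mul, norm_neg, Complex.norm_I, one_mul, Complex.norm_real, mul_pow]
  gcongr
  rw [Real.norm_eq_abs]
  exact (abs_lt.2 hτ).le

end FourierOn

/-! ### Weighted exponentials and the passage to lattice nodes. -/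

section WeightedExp

variable {ι : Type*}

/-- The family of exponentials with frequencies `ξ i`, normalized by `√(w i / 2π)`. -/
noncomputable def weightedExp (T : ℝ) (w ξ : ι → ℝ) (i : ι) : L2Sym T :=
  ((√(w i / (2 * Real.pi)) : ℝ) : ℂ) • expL2 T (ξ i)

theorem inner_weightedExp (T : ℝ) (w ξ : ι → ℝ) (i : ι) (g : L2Sym T) :
    inner ℂ (weightedExp T w ξ i) g =
      ((√(w i / (2 * Real.pi)) : ℝ) : ℂ) * fourierOn T g (ξ i) := by
  rw [weightedExp, inner_smul_left, Complex.conj_ofReal, inner_expL2]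

theorem inner_mul_inner_weightedExp (T : ℝ) {w : ι → ℝ} (hw : ∀ i, 0 ≤ w i) (ξ : ι → ℝ) (i : ι)
    (f g : L2Sym T) :
    inner ℂ f (weightedExp T w ξ i) * inner ℂ (weightedExp T w ξ i) g =
      ((w i / (2 * Real.pi) : ℝ) : ℂ) *
        (inner ℂ f (expL2 T (ξ i)) * inner ℂ (expL2 T (ξ i)) g) := by
  have := Real.pi_pos
  have h : ((√(w i / (2 * Real.pi)) : ℝ) : ℂ) * ((√(w i / (2 * Real.pi)) : ℝ) : ℂ) =
      ((w i / (2 * Real.pi) : ℝ) : ℂ) := by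
    rw [← Complex.ofReal_mul, Real.mul_self_sqrt (div_nonneg (hw i) (by positivity))]
  rw [weightedExp, inner_smul_left, inner_smul_right, Complex.conj_ofReal, ← h]
  ring

theorem norm_sqrt_mul_sq {a : ℝ} (ha : 0 ≤ a) (z : ℂ) :
    ‖((√(a / (2 * Real.pi)) : ℝ) : ℂ) * z‖ ^ 2 = a / (2 * Real.pi) * ‖z‖ ^ 2 := by
  have := Real.pi_pos
  rw [norm_mul, mul_pow, Complex.norm_real, Real.norm_of_nonneg (Real.sqrt_nonneg _),
    Real.sq_sqrt (by positivity)]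

theorem norm_sq_L2Sym {T : ℝ} (g : L2Sym T) : ‖g‖ ^ 2 = ∫ t in Set.Ioo (-T) T, ‖g t‖ ^ 2 := by
  have h := congrArg Complex.re (L2.inner_def (𝕜 := ℂ) g g)
  rw [inner_self_eq_norm_sq_to_K] at h
  have e : ∀ t, inner ℂ (g t) (g t) = ((‖g t‖ ^ 2 : ℝ) : ℂ) := fun t => by
    rw [inner_self_eq_norm_sq_to_K]; simp
  simp only [e] at h
  rw [integral_complex_ofReal] at h
  exact_mod_cast h

/-- Group the indices by node; `C` bounds the weight gathered at each one. -/
theorem sum_mul_comp_le {node : ι → ℤ} {w : ι → ℝ} {C : ℝ}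
    (hC : ∀ (j : ℤ) (s : Finset ι), (∀ i ∈ s, node i = j) → ∑ i ∈ s, w i ≤ C)
    {y : ℤ → ℝ} (hy : ∀ j, 0 ≤ y j) (s : Finset ι) :
    ∑ i ∈ s, w i * y (node i) ≤ C * ∑ j ∈ s.image node, y j := by
  classical
  rw [← Finset.sum_fiberwise_of_maps_to (g := node) (t := s.image node)
    (fun i hi => Finset.mem_image_of_mem _ hi), Finset.mul_sum]
  refine Finset.sum_le_sum fun j _ => ?_
  calc ∑ i ∈ s with node i = j, w i * y (node i) = (∑ i ∈ s with node i = j, w i) * y j := by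
        rw [Finset.sum_mul]
        refine Finset.sum_congr rfl fun i hi => ?_
        rw [(Finset.mem_filter.1 hi).2]
    _ ≤ C * y j :=
        mul_le_mul_of_nonneg_right (hC j _ fun i hi => (Finset.mem_filter.1 hi).2) (hy j)

variable {T : ℝ} (hT : 0 < T) {m : ℕ} (hm : m ≠ 0) {h : ℝ} (hh : h = Real.pi / (T * m))
  {node : ι → ℤ} {w ξ : ι → ℝ} (hw : ∀ i, 0 ≤ w i) {C : ℝ}
  (hC : ∀ (j : ℤ) (s : Finset ι), (∀ i ∈ s, node i = j) → ∑ i ∈ s, w i ≤ C)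
include hT hm hh

/-- Weight `h` at each node cancels the factor `2π/h` of Parseval: this family is a Parseval frame,
the reference for density one. -/
theorem hasSum_weightedExp_lattice (g : L2Sym T) :
    HasSum (fun j : ℤ => ‖inner ℂ (weightedExp T (fun _ : ℤ => h) (fun j : ℤ => j * h) j) g‖ ^ 2)
      (‖g‖ ^ 2) := by
  have hm0 : (0 : ℝ) < m := by positivity
  have hh0 : 0 < h := by rw [hh]; positivity
  have hp := Real.pi_pos
  simp only [inner_weightedExp, norm_sqrt_mul_sq hh0.le]
  have := (hasSum_norm_sq_fourierOn hT hm (Lp.memLp g) hh).mul_left (h / (2 * Real.pi))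
  rw [← norm_sq_L2Sym] at this
  have e : h / (2 * Real.pi) * (2 * Real.pi / h * ‖g‖ ^ 2) = ‖g‖ ^ 2 := by field_simp
  rwa [e] at this

theorem isBessel_weightedExp_lattice :
    IsBessel (weightedExp T (fun _ : ℤ => h) (fun j : ℤ => j * h)) 1 := fun g s => by
  rw [one_mul]
  exact sum_le_hasSum s (fun _ _ => by positivity) (hasSum_weightedExp_lattice hT hm hh g)

include hw hC

theorem isBessel_weightedExp_node :
    IsBessel (weightedExp T w fun i => node i * h) (C / h) := fun g s => by
  classical
  have hm0 : (0 : ℝ) < m := by positivity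
  have hh0 : 0 < h := by rw [hh]; positivity
  have hp := Real.pi_pos
  have hC0 : 0 ≤ C := by simpa using hC 0 ∅ (by simp)
  have hP := hasSum_norm_sq_fourierOn hT hm (Lp.memLp g) hh
  rw [← norm_sq_L2Sym] at hP
  simp only [inner_weightedExp, fun i => norm_sqrt_mul_sq (hw i)]
  calc ∑ i ∈ s, w i / (2 * Real.pi) * ‖fourierOn T g (node i * h)‖ ^ 2
      = (1 / (2 * Real.pi)) * ∑ i ∈ s, w i * ‖fourierOn T g (node i * h)‖ ^ 2 := by
        rw [Finset.mul_sum]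
        exact Finset.sum_congr rfl fun i _ => by ring
    _ ≤ (1 / (2 * Real.pi)) * (C * ∑ j ∈ s.image node, ‖fourierOn T g (j * h)‖ ^ 2) := by
        gcongr
        exact sum_mul_comp_le hC (y := fun j => ‖fourierOn T g (j * h)‖ ^ 2)
          (fun _ => by positivity) s
    _ ≤ (1 / (2 * Real.pi)) * (C * (2 * Real.pi / h * ‖g‖ ^ 2)) := by
        gcongr
        exact sum_le_hasSum _ (fun _ _ => by positivity) hP
    _ = C / h * ‖g‖ ^ 2 := by field_simp

/-- The transform of `g` has derivative the transform of `-iτ g(τ)`, of norm at most `T‖g‖`.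
Integrating over the window around each node and summing over nodes inside the integral leaves
shifted Parseval sums. The bound vanishes with `h` as long as `C` stays bounded. -/
theorem isBessel_weightedExp_sub_node (hξ : ∀ i, |ξ i - node i * h| ≤ h) :
    IsBessel (fun i => weightedExp T w ξ i - weightedExp T w (fun i => node i * h) i)
      (4 * C * T ^ 2 * h) := fun g s => by
  classical
  have hm0 : (0 : ℝ) < m := by positivity
  have hh0 : 0 < h := by rw [hh]; positivity
  have hp := Real.pi_pos
  have hC0 : 0 ≤ C := by simpa using hC 0 ∅ (by simp)
  have hg := Lp.memLp g
  have hgi : Integrable g (volume.restrict (Set.Ioo (-T) T)) := hg.integrable (by norm_num)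
  set g' : ℝ → ℂ := fun τ => -Complex.I * τ * g τ
  have hg' : MemLp g' 2 (volume.restrict (Set.Ioo (-T) T)) := memLp_neg_I_mul hg
  have hc' : Continuous (fourierOn T g') := continuous_fourierOn (hg'.integrable (by norm_num))
  -- Uniform in the shift `u`, which is what permits integrating over the window after summing.
  have key : ∀ t : Finset ℤ, ∀ u : ℝ, ∑ j ∈ t, ‖fourierOn T g' (j * h + u)‖ ^ 2 ≤
      2 * Real.pi / h * (T ^ 2 * ‖g‖ ^ 2) := fun t u => by
    refine (sum_le_hasSum t (fun _ _ => by positivity)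
      (hasSum_norm_sq_fourierOn_add hT hm hg' hh u)).trans ?_
    rw [norm_sq_L2Sym]
    gcongr
    exact integral_neg_I_mul_sq_le hg
  simp only [inner_sub_left, inner_weightedExp, ← mul_sub, fun i => norm_sqrt_mul_sq (hw i)]
  calc ∑ i ∈ s, w i / (2 * Real.pi) * ‖fourierOn T g (ξ i) - fourierOn T g (node i * h)‖ ^ 2
      ≤ ∑ i ∈ s, w i / (2 * Real.pi) *
          (2 * h * ∫ u in (-h)..h, ‖fourierOn T g' (node i * h + u)‖ ^ 2) := by
        refine Finset.sum_le_sum fun i _ => ?_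
        refine mul_le_mul_of_nonneg_left ?_ (div_nonneg (hw i) (by positivity))
        exact norm_sub_sq_le_integral (fun x => hasDerivAt_fourierOn hgi x) hc' hh0 (hξ i)
    _ = (h / Real.pi) * ∑ i ∈ s, w i *
          ∫ u in (-h)..h, ‖fourierOn T g' (node i * h + u)‖ ^ 2 := by
        rw [Finset.mul_sum]
        exact Finset.sum_congr rfl fun i _ => by field_simp
    _ ≤ (h / Real.pi) * (C * ∑ j ∈ s.image node,
          ∫ u in (-h)..h, ‖fourierOn T g' (j * h + u)‖ ^ 2) := by
        gcongr
        exact sum_mul_comp_le hC (y := fun j => ∫ u in (-h)..h, ‖fourierOn T g' (j * h + u)‖ ^ 2)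
          (fun _ => intervalIntegral.integral_nonneg (by linarith) fun _ _ => by positivity) s
    _ = (h / Real.pi) * (C * ∫ u in (-h)..h,
          ∑ j ∈ s.image node, ‖fourierOn T g' (j * h + u)‖ ^ 2) := by
        rw [intervalIntegral.integral_finsetSum]
        exact fun j _ => Continuous.intervalIntegrable (by fun_prop) _ _
    _ ≤ (h / Real.pi) * (C * ∫ _ in (-h)..h, 2 * Real.pi / h * (T ^ 2 * ‖g‖ ^ 2)) := by
        gcongr
        refine intervalIntegral.integral_mono_on (by linarith)
          (Continuous.intervalIntegrable (by fun_prop) _ _)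
          (Continuous.intervalIntegrable (by fun_prop) _ _) fun u _ => key _ u
    _ = 4 * C * T ^ 2 * h * ‖g‖ ^ 2 := by
        rw [intervalIntegral.integral_const, smul_eq_mul]
        field_simp
        ring

theorem isBessel_weightedExp (hξ : ∀ i, |ξ i - node i * h| ≤ h) :
    IsBessel (weightedExp T w ξ) (2 * (C / h + 4 * C * T ^ 2 * h)) := by
  have := (isBessel_weightedExp_node hT hm hh hw hC).sub
    (isBessel_weightedExp_sub_node hT hm hh hw hC hξ).neg
  simpa using this

/-- Collecting the weights at each node writes the frame operator as the sum of `ν j / h` times the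
rank-one operators of the lattice frame, and the identity is the same sum with coefficients one. The
difference is a multiplier with symbol `ν j / h - A`, which tends to zero. -/
theorem isCompactOperator_node_sub {B A : ℝ}
    (hV : IsBessel (weightedExp T w fun i => node i * h) B)
    {ν : ℤ → ℝ} (hν : ∀ j, HasSum (fun i : {i // node i = j} => w i) (ν j))
    (hlim : Tendsto (fun j => ν j / h) cofinite (𝓝 A)) :
    IsCompactOperator (hV.analysis.adjoint ∘L hV.analysis -
      (A : ℂ) • ContinuousLinearMap.id ℂ (L2Sym T)) := by
  have hm0 : (0 : ℝ) < m := by positivity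
  have hh0 : 0 < h := by rw [hh]; positivity
  have hp := Real.pi_pos
  have hν0 : ∀ j, 0 ≤ ν j := fun j =>
    HasSum.nonneg (g := fun i : {i // node i = j} => w i) (fun i => hw i) (hν j)
  have hνC : ∀ j, ν j ≤ C := fun j => by
    refine le_of_tendsto (hν j) (Eventually.of_forall fun s => ?_)
    have := hC j (s.map (Function.Embedding.subtype _)) fun i hi => by
      obtain ⟨i', _, rfl⟩ := Finset.mem_map.1 hi
      exact i'.2
    simpa using this
  set u := weightedExp T (fun _ : ℤ => h) (fun j : ℤ => j * h) with hu
  have hU : IsBessel u 1 := isBessel_weightedExp_lattice hT hm hh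
  set c : ℤ → ℂ := fun j => ((ν j / h - A : ℝ) : ℂ) with hc
  have hcb : ∀ j, ‖c j‖ ≤ C / h + |A| := fun j => by
    rw [hc, Complex.norm_real]
    refine (norm_sub_le _ _).trans ?_
    rw [Real.norm_of_nonneg (div_nonneg (hν0 j) hh0.le), Real.norm_eq_abs]
    gcongr
    exact hνC j
  have hUc := hU.smul hcb
  have hclim : Tendsto c cofinite (𝓝 0) := by
    have := (Complex.continuous_ofReal.tendsto _).comp (hlim.sub_const A)
    simpa [Function.comp_def, hc] using this
  have e : hV.analysis.adjoint ∘L hV.analysis - (A : ℂ) • ContinuousLinearMap.id ℂ (L2Sym T) =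
      hU.analysis.adjoint ∘L hUc.analysis := by
    ext1 g
    refine ext_inner_left ℂ fun f => ?_
    set x : ℤ → ℂ := fun j => inner ℂ f (expL2 T (j * h)) * inner ℂ (expL2 T (j * h)) g
    have h1 := hV.hasSum_inner hV f g
    have h2 := hU.hasSum_inner hU f g
    rw [hU.adjoint_analysis_comp_self (hasSum_weightedExp_lattice hT hm hh)] at h2
    have h3 := hU.hasSum_inner hUc f g
    simp only [inner_smul_left, mul_left_comm _ ((starRingEnd ℂ) _) _] at h3
    simp only [inner_mul_inner_weightedExp T hw] at h1
    simp only [hu, inner_mul_inner_weightedExp T (fun _ : ℤ => hh0.le)] at h2 h3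
    have h4 : HasSum (fun j => ((ν j / (2 * Real.pi) : ℝ) : ℂ) * x j)
        (inner ℂ f (hV.analysis.adjoint (hV.analysis g))) := by
      -- Regroup the sum over indices into the fibres of `node`; on a fibre the exponential is
      -- constant and the weights add up to `ν j`.
      refine HasSum.sigma ((Equiv.sigmaFiberEquiv node).hasSum_iff.2 h1) fun j => ?_
      have h5 : HasSum (fun i : {i // node i = j} => ((w i / (2 * Real.pi) : ℝ) : ℂ))
          ((ν j / (2 * Real.pi) : ℝ) : ℂ) :=
        Complex.hasSum_ofReal.2 ((hν j).div_const _)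
      have h6 := h5.mul_right (x j)
      have h7 : (fun i : {i // node i = j} => ((w i / (2 * Real.pi) : ℝ) : ℂ) * x j) =
          fun i : {i // node i = j} => ((w i / (2 * Real.pi) : ℝ) : ℂ) * x (node i) :=
        funext fun ⟨i, hi⟩ => by simp only [hi]
      rw [h7] at h6
      exact h6
    rw [sub_apply, inner_sub_right, ContinuousLinearMap.comp_apply, ContinuousLinearMap.comp_apply]
    have h7 := h4.sub (h2.mul_left (A : ℂ))
    have h8 : inner ℂ f (((A : ℂ) • ContinuousLinearMap.id ℂ (L2Sym T)) g) =
        (A : ℂ) * inner ℂ f g := inner_smul_right _ _ _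
    rw [h8]
    refine h7.unique ?_
    have key : ∀ j : ℤ, ((ν j / (2 * Real.pi) : ℝ) : ℂ) * x j -
        (A : ℂ) * (((h / (2 * Real.pi) : ℝ) : ℂ) * x j) =
        (starRingEnd ℂ) (c j) * (((h / (2 * Real.pi) : ℝ) : ℂ) * x j) := fun j => by
      simp only [hc, Complex.conj_ofReal]
      have : (h : ℂ) ≠ 0 := by exact_mod_cast hh0.ne'
      have : (Real.pi : ℂ) ≠ 0 := by exact_mod_cast hp.ne'
      push_cast
      field_simp
    simp only [x] at key
    simp only [x, key]
    exact h3
  rw [e]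
  exact hU.isCompactOperator_multiplier hUc hclim

end WeightedExp

/-! ### The weights `1/n` in logarithmic blocks and their relation to the counting function. -/

section Arithmetic

variable (K : Set ℕ)

/-- The weight `1/n` of `n ∈ K`. -/
noncomputable def recipWeight (n : ℕ) : ℝ := K.indicator (fun n : ℕ => (n : ℝ)⁻¹) n

theorem recipWeight_nonneg (n : ℕ) : 0 ≤ recipWeight K n :=
  Set.indicator_nonneg (fun _ _ => by positivity) _

theorem recipWeight_le (n : ℕ) : recipWeight K n ≤ (n : ℝ)⁻¹ :=
  Set.indicator_le_self' (fun _ _ => by positivity) _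

@[simp]
theorem recipWeight_zero : recipWeight K 0 = 0 := by
  by_cases h : 0 ∈ K <;> simp [recipWeight, h]

/-- The weights of the frequencies `± log n`, `n ∈ K`. -/
noncomputable def zetaWeight : ℕ ⊕ ℕ → ℝ := Sum.elim (recipWeight K) (recipWeight K)

/-- The frequencies `± log n`. -/
noncomputable def zetaFreq : ℕ ⊕ ℕ → ℝ :=
  Sum.elim (fun n => Real.log n) (fun n => -Real.log n)

/-- The index of the node of `hℤ` that approximates the frequency `± log n`. -/
noncomputable def zetaNode (h : ℝ) : ℕ ⊕ ℕ → ℤ :=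
  Sum.elim (fun n => ⌈Real.log n / h⌉) (fun n => -⌈Real.log n / h⌉)

theorem zetaWeight_nonneg (i : ℕ ⊕ ℕ) : 0 ≤ zetaWeight K i := by
  cases i <;> exact recipWeight_nonneg K _

theorem abs_zetaFreq_sub_le {h : ℝ} (hh : 0 < h) (i : ℕ ⊕ ℕ) :
    |zetaFreq i - zetaNode h i * h| ≤ h := by
  have key : ∀ x : ℝ, |x - ⌈x / h⌉ * h| ≤ h := fun x => by
    have h1 := Int.le_ceil (x / h)
    have h2 := Int.ceil_lt_add_one (x / h)
    rw [div_le_iff₀ hh] at h1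
    have h3 : (⌈x / h⌉ : ℝ) * h ≤ (x / h + 1) * h := by gcongr
    rw [add_mul, div_mul_cancel₀ _ hh.ne'] at h3
    rw [abs_le]
    constructor <;> linarith
  cases i with
  | inl n => exact key _
  | inr n =>
    have : zetaFreq (.inr n) - zetaNode h (.inr n) * h =
        -(Real.log n - ⌈Real.log n / h⌉ * h) := by
      simp only [zetaFreq, zetaNode, Sum.elim_inr]
      push_cast
      ring
    rw [this, abs_neg]
    exact key _

theorem ceil_log_div_eq_iff {h : ℝ} (hh : 0 < h) {n : ℕ} (hn : n ≠ 0) (j : ℤ) :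
    ⌈Real.log n / h⌉ = j ↔
      n ∈ Finset.Ioc ⌊Real.exp ((j - 1) * h)⌋₊ ⌊Real.exp (j * h)⌋₊ := by
  have hn' : (0 : ℝ) < n := by positivity
  rw [Int.ceil_eq_iff, lt_div_iff₀ hh, div_le_iff₀ hh, Finset.mem_Ioc,
    Nat.floor_lt (Real.exp_pos _).le, Nat.le_floor_iff (Real.exp_pos _).le,
    Real.lt_log_iff_exp_lt hn', Real.log_le_iff_le_exp hn']

/-- Crude: at most `b` terms, each below `1/a`. For a block `b/a = e^h`, which need only stay
bounded as `h → 0`. -/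
theorem sum_recipWeight_Ioc_le {a b : ℝ} (ha : 0 < a) (hb : 0 ≤ b) (s : Finset ℕ)
    (hs : s ⊆ Finset.Ioc ⌊a⌋₊ ⌊b⌋₊) : ∑ n ∈ s, recipWeight K n ≤ b / a := by
  have hc : s.card ≤ ⌊b⌋₊ :=
    (Finset.card_le_card hs).trans (by rw [Nat.card_Ioc]; exact Nat.sub_le _ _)
  calc ∑ n ∈ s, recipWeight K n ≤ ∑ n ∈ s, a⁻¹ := by
        refine Finset.sum_le_sum fun n hn => (recipWeight_le K n).trans ?_
        have := (Finset.mem_Ioc.1 (hs hn)).1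
        rw [Nat.floor_lt ha.le] at this
        gcongr
    _ = s.card * a⁻¹ := by rw [Finset.sum_const, nsmul_eq_mul]
    _ ≤ b * a⁻¹ := by
        gcongr
        exact (Nat.cast_le.2 hc).trans (Nat.floor_le hb)
    _ = b / a := by rw [div_eq_mul_inv]

theorem sum_recipWeight_le {h : ℝ} (hh : 0 < h) (j : ℤ) (s : Finset ℕ)
    (hs : ∀ n ∈ s, ⌈Real.log n / h⌉ = j) : ∑ n ∈ s, recipWeight K n ≤ Real.exp h := by
  have e : ∑ n ∈ s with n ≠ 0, recipWeight K n = ∑ n ∈ s, recipWeight K n := by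
    refine Finset.sum_filter_of_ne fun n _ hn h0 => hn ?_
    rw [h0, recipWeight_zero]
  rw [← e]
  refine (sum_recipWeight_Ioc_le K (Real.exp_pos ((j - 1) * h)) (Real.exp_pos (j * h)).le _
    fun n hn => ?_).trans_eq ?_
  · rw [Finset.mem_filter] at hn
    exact (ceil_log_div_eq_iff hh hn.2 j).1 (hs n hn.1)
  · rw [← Real.exp_sub]
    ring_nf

theorem sum_zetaWeight_le {h : ℝ} (hh : 0 < h) (j : ℤ) (s : Finset (ℕ ⊕ ℕ))
    (hs : ∀ i ∈ s, zetaNode h i = j) : ∑ i ∈ s, zetaWeight K i ≤ 2 * Real.exp h := by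
  rw [← Finset.toLeft_disjSum_toRight (u := s), Finset.sum_disjSum]
  have h1 := sum_recipWeight_le K hh j s.toLeft fun n hn => hs _ (Finset.mem_toLeft.1 hn)
  have h2 := sum_recipWeight_le K hh (-j) s.toRight fun n hn => by
    have := hs _ (Finset.mem_toRight.1 hn)
    simp only [zetaNode, Sum.elim_inr] at this
    omega
  simp only [zetaWeight, Sum.elim_inl, Sum.elim_inr]
  linarith

/-- The total weight `∑ 1/n` over those `n ∈ K` with `(j-1)h < log n ≤ jh`. -/
noncomputable def blockWeight (h : ℝ) (j : ℤ) : ℝ :=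
  ∑ n ∈ Finset.Ioc ⌊Real.exp ((j - 1) * h)⌋₊ ⌊Real.exp (j * h)⌋₊, recipWeight K n

theorem hasSum_blockWeight {h : ℝ} (hh : 0 < h) (j : ℤ) :
    HasSum ({n : ℕ | ⌈Real.log n / h⌉ = j}.indicator (recipWeight K)) (blockWeight K h j) := by
  have h1 : blockWeight K h j =
      ∑ n ∈ Finset.Ioc ⌊Real.exp ((j - 1) * h)⌋₊ ⌊Real.exp (j * h)⌋₊,
        {n : ℕ | ⌈Real.log n / h⌉ = j}.indicator (recipWeight K) n := by
    refine Finset.sum_congr rfl fun n hn => ?_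
    have hn0 : n ≠ 0 := by have := (Finset.mem_Ioc.1 hn).1; omega
    rw [Set.indicator_of_mem]
    exact (ceil_log_div_eq_iff hh hn0 j).2 hn
  rw [h1]
  refine hasSum_sum_of_ne_finset_zero fun n hn => ?_
  -- The index `0` lies in the fibre of `j = 0`, because `Real.log 0 = 0`, but outside the block;
  -- its weight is zero.
  rcases eq_or_ne n 0 with rfl | hn0
  · by_cases h0 : (0 : ℕ) ∈ {n : ℕ | ⌈Real.log n / h⌉ = j} <;> simp [Set.indicator]
  · rw [Set.indicator_of_notMem]
    exact fun hj => hn ((ceil_log_div_eq_iff hh hn0 j).1 hj)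

theorem hasSum_zetaWeight_fiber {h : ℝ} (hh : 0 < h) (j : ℤ) :
    HasSum (fun i : {i // zetaNode h i = j} => zetaWeight K i)
      (blockWeight K h j + blockWeight K h (-j)) := by
  refine (hasSum_subtype_iff_indicator (s := {i | zetaNode h i = j})).2 ?_
  refine HasSum.sum ?_ ?_
  · exact hasSum_blockWeight K hh j
  · have e : ({i | zetaNode h i = j}.indicator (zetaWeight K)) ∘ Sum.inr =
        {n : ℕ | ⌈Real.log n / h⌉ = -j}.indicator (recipWeight K) := by
      ext n
      have : (.inr n : ℕ ⊕ ℕ) ∈ {i | zetaNode h i = j} ↔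
          n ∈ {n : ℕ | ⌈Real.log n / h⌉ = -j} := by
        simp only [Set.mem_ofPred_eq, zetaNode, Sum.elim_inr]; omega
      by_cases hn : n ∈ {n : ℕ | ⌈Real.log n / h⌉ = -j}
      · rw [Function.comp_apply, Set.indicator_of_mem (this.2 hn), Set.indicator_of_mem hn]
        rfl
      · rw [Function.comp_apply, Set.indicator_of_notMem (mt this.1 hn),
          Set.indicator_of_notMem hn]
    have := hasSum_blockWeight K hh (-j)
    rw [← e] at this
    exact this

theorem kCount_eq_sum {t : ℝ} (ht : 0 ≤ t) :
    (kCount K t : ℝ) = ∑ n ∈ Finset.Icc 0 ⌊t⌋₊, (K \ {0}).indicator (fun _ => (1 : ℝ)) n := by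
  classical
  have e : {n : ℕ | n ∈ K ∧ 1 ≤ n ∧ (n : ℝ) ≤ t} =
      ((Finset.Icc 0 ⌊t⌋₊).filter (· ∈ K \ {0}) : Finset ℕ) := by
    ext n
    simp only [Set.mem_ofPred_eq, Finset.coe_filter, Finset.mem_Icc, Nat.le_floor_iff ht,
      Set.mem_sdiff, Set.mem_singleton_iff]
    constructor
    · rintro ⟨h1, h2, h3⟩; exact ⟨⟨by omega, h3⟩, h1, by omega⟩
    · rintro ⟨⟨_, h3⟩, h1, h2⟩; exact ⟨h1, by omega, h3⟩
  rw [kCount, e, Set.ncard_coe_finset, Finset.card_filter]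
  push_cast
  exact Finset.sum_congr rfl fun n _ => by simp [Set.indicator]

/-- Partial summation against `1/t`. Integrability is recorded because the limit argument subtracts
integrals. -/
theorem sum_recipWeight_eq {a b : ℝ} (ha : 0 < a) (hab : a ≤ b) :
    ∑ n ∈ Finset.Ioc ⌊a⌋₊ ⌊b⌋₊, recipWeight K n =
      kCount K b / b - kCount K a / a + ∫ t in Set.Ioc a b, kCount K t / t / t ∧
    IntegrableOn (fun t => (kCount K t : ℝ) / t / t) (Set.Ioc a b) := by
  set c : ℕ → ℝ := (K \ {0}).indicator (fun _ => (1 : ℝ))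
  have hd : ∀ t ∈ Set.Icc a b, t ≠ 0 := fun t ht => (ha.trans_le ht.1).ne'
  have hint : IntegrableOn (deriv fun t : ℝ => t⁻¹) (Set.Icc a b) := by
    rw [deriv_inv']
    refine ContinuousOn.integrableOn_Icc (ContinuousOn.neg ?_)
    exact ContinuousOn.inv₀ (by fun_prop) fun t ht => pow_ne_zero 2 (hd t ht)
  have h1 := sum_mul_eq_sub_sub_integral_mul c ha.le hab (f := fun t => t⁻¹)
    (fun t ht => differentiableAt_inv (hd t ht)) hint
  have h2 : ∀ n ∈ Finset.Ioc ⌊a⌋₊ ⌊b⌋₊, (n : ℝ)⁻¹ * c n = recipWeight K n := fun n hn => by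
    have hn0 : n ≠ 0 := by have := (Finset.mem_Ioc.1 hn).1; omega
    by_cases hK : n ∈ K <;> simp [c, recipWeight, hK, hn0]
  rw [Finset.sum_congr rfl h2, ← kCount_eq_sum K (ha.le.trans hab), ← kCount_eq_sum K ha.le] at h1
  have h3 : Set.EqOn (fun t => deriv (fun t : ℝ => t⁻¹) t * ∑ n ∈ Finset.Icc 0 ⌊t⌋₊, c n)
      (fun t => -((kCount K t : ℝ) / t / t)) (Set.Ioc a b) := fun t ht => by
    have ht0 : t ≠ 0 := hd t (Set.Ioc_subset_Icc_self ht)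
    simp only [deriv_inv']
    rw [← kCount_eq_sum K (ha.le.trans ht.1.le)]
    field_simp
  constructor
  · rw [h1, setIntegral_congr_fun measurableSet_Ioc h3, integral_neg]
    ring
  · have h4 := (integrableOn_mul_sum_Icc c (m := 0) ha.le hint).mono_set Set.Ioc_subset_Icc_self
    have h5 := (h4.congr_fun h3 measurableSet_Ioc).neg
    simpa using h5

/-- In the partial summation formula the two boundary terms both tend to `A` and cancel, while the
integral approaches `A ∫ dt/t = A h`, the window having logarithmic length `h`. -/
theorem tendsto_sum_recipWeight {A : ℝ}
    (hK : Tendsto (fun x : ℝ => (kCount K x : ℝ) / x) atTop (𝓝 A)) {h : ℝ} (hh : 0 < h) :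
    Tendsto (fun x : ℝ => ∑ n ∈ Finset.Ioc ⌊x * Real.exp (-h)⌋₊ ⌊x⌋₊, recipWeight K n) atTop
      (𝓝 (A * h)) := by
  have he : 0 < Real.exp (-h) := Real.exp_pos _
  have he1 : Real.exp (-h) ≤ 1 := Real.exp_le_one_iff.2 (by linarith)
  have hscale : Tendsto (fun x : ℝ => x * Real.exp (-h)) atTop atTop :=
    tendsto_id.atTop_mul_const he
  have hlog : ∀ x : ℝ, 0 < x → ∫ t in Set.Ioc (x * Real.exp (-h)) x, t⁻¹ = h := fun x hx => by
    rw [← intervalIntegral.integral_of_le (mul_le_of_le_one_right hx.le he1),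
      integral_inv_of_pos (by positivity) hx, div_mul_cancel_left₀ hx.ne', Real.exp_neg, inv_inv,
      Real.log_exp]
  have hinv : ∀ x : ℝ, 0 < x → IntegrableOn (fun t : ℝ => t⁻¹)
      (Set.Ioc (x * Real.exp (-h)) x) := fun x hx =>
    (ContinuousOn.integrableOn_Icc (ContinuousOn.inv₀ (by fun_prop) fun t ht =>
      ((mul_pos hx he).trans_le ht.1).ne')).mono_set Set.Ioc_subset_Icc_self
  have hI : Tendsto (fun x : ℝ => ∫ t in Set.Ioc (x * Real.exp (-h)) x, (kCount K t : ℝ) / t / t)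
      atTop (𝓝 (A * h)) := by
    rw [Metric.tendsto_atTop]
    intro ε hε
    -- Integrated against `dt/t` over the window, this error contributes `ε/2`.
    have hδ : 0 < ε / (2 * h) := by positivity
    obtain ⟨N, hN⟩ := Metric.tendsto_atTop.1 hK _ hδ
    obtain ⟨M, hM⟩ := (tendsto_atTop.1 hscale N).exists_forall_of_atTop
    refine ⟨max M 1, fun x hx => ?_⟩
    have hx0 : 0 < x := lt_of_lt_of_le one_pos ((le_max_right _ _).trans hx)
    have hxN := hM x ((le_max_left _ _).trans hx)
    have hxe : 0 < x * Real.exp (-h) := by positivity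
    have hint := (sum_recipWeight_eq K hxe (mul_le_of_le_one_right hx0.le he1)).2
    have e : A * h = ∫ t in Set.Ioc (x * Real.exp (-h)) x, A * t⁻¹ := by
      rw [integral_const_mul, hlog x hx0]
    rw [dist_eq_norm, e, ← integral_sub hint ((hinv x hx0).const_mul A)]
    have hle : ‖∫ t in Set.Ioc (x * Real.exp (-h)) x, ((kCount K t : ℝ) / t / t - A * t⁻¹)‖ ≤
        ∫ t in Set.Ioc (x * Real.exp (-h)) x, ε / (2 * h) * t⁻¹ := by
      refine norm_integral_le_of_norm_le ((hinv x hx0).const_mul (ε / (2 * h))) ?_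
      filter_upwards [ae_restrict_mem measurableSet_Ioc] with t ht
      have ht0 : 0 < t := hxe.trans ht.1
      have := hN t (hxN.trans ht.1.le)
      rw [dist_eq_norm] at this
      rw [div_eq_mul_inv _ t, ← sub_mul, norm_mul, Real.norm_of_nonneg (inv_pos.2 ht0).le]
      gcongr
    rw [integral_const_mul, hlog x hx0] at hle
    refine hle.trans_lt ?_
    have : ε / (2 * h) * h = ε / 2 := by field_simp
    linarith
  have h2 := (hK.sub (hK.comp hscale)).add hI
  rw [sub_self, zero_add] at h2
  refine h2.congr' ?_
  filter_upwards [eventually_gt_atTop 0] with x hx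
  exact (sum_recipWeight_eq K (by positivity) (mul_le_of_le_one_right hx.le he1)).1.symm

theorem blockWeight_of_neg {h : ℝ} (hh : 0 < h) {j : ℤ} (hj : j < 0) : blockWeight K h j = 0 := by
  have hj' : (j : ℝ) < 0 := by exact_mod_cast hj
  have : ⌊Real.exp (j * h)⌋₊ = 0 :=
    Nat.floor_eq_zero.2 (Real.exp_lt_one_iff.2 (mul_neg_of_neg_of_pos hj' hh))
  simp [blockWeight, this]

theorem tendsto_blockWeight {A : ℝ}
    (hK : Tendsto (fun x : ℝ => (kCount K x : ℝ) / x) atTop (𝓝 A)) {h : ℝ} (hh : 0 < h) :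
    Tendsto (fun j : ℤ => (blockWeight K h j + blockWeight K h (-j)) / h) cofinite (𝓝 A) := by
  have h1 : Tendsto (fun j : ℤ => blockWeight K h j / h) atTop (𝓝 A) := by
    have h2 : Tendsto (fun j : ℤ => Real.exp (j * h)) atTop atTop :=
      Real.tendsto_exp_atTop.comp (tendsto_intCast_atTop_atTop.atTop_mul_const hh)
    have h3 := ((tendsto_sum_recipWeight K hK hh).comp h2).div_const h
    rw [mul_div_cancel_right₀ _ hh.ne'] at h3
    refine h3.congr fun j => ?_
    simp only [Function.comp_apply, blockWeight]
    rw [← Real.exp_add]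
    ring_nf
  -- Near `+∞` only the block of `j` survives and near `-∞` only that of `-j`; the double count at
  -- `j = 0` is harmless.
  rw [Int.cofinite_eq, tendsto_sup]
  constructor
  · refine (h1.comp tendsto_neg_atBot_atTop).congr' ?_
    filter_upwards [eventually_lt_atBot 0] with j hj
    simp [blockWeight_of_neg K hh hj]
  · refine h1.congr' ?_
    filter_upwards [eventually_gt_atTop 0] with j hj
    rw [blockWeight_of_neg K hh (neg_lt_zero.2 hj), add_zero]

end Arithmetic

/-! ### The zeta operator as a frame operator, and compactness from density. -/

section ZetaOperator

variable (K : Set ℕ)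

/-- The coarsest lattice, `m = 1`, suffices here; only finiteness of the bound matters. -/
theorem isBessel_zeta {T : ℝ} (hT : 0 < T) :
    IsBessel (weightedExp T (zetaWeight K) zetaFreq)
      (2 * (2 * Real.exp (Real.pi / T) / (Real.pi / T) +
        4 * (2 * Real.exp (Real.pi / T)) * T ^ 2 * (Real.pi / T))) := by
  have hh : 0 < Real.pi / T := by have := Real.pi_pos; positivity
  exact isBessel_weightedExp hT one_ne_zero (by simp) (zetaWeight_nonneg K)
    (sum_zetaWeight_le K hh) (abs_zetaFreq_sub_le hh)

/-- The damping factors `n^{-δ}`. -/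
noncomputable def zetaDamping (δ : ℝ) : ℕ ⊕ ℕ → ℝ :=
  Sum.elim (fun n => (n : ℝ) ^ (-δ)) (fun n => (n : ℝ) ^ (-δ))

theorem rpow_neg_nonneg_le_one {δ : ℝ} (hδ : 0 ≤ δ) (n : ℕ) :
    0 ≤ (n : ℝ) ^ (-δ) ∧ (n : ℝ) ^ (-δ) ≤ 1 := by
  refine ⟨by positivity, ?_⟩
  rcases Nat.eq_zero_or_pos n with rfl | hn
  · simpa using Real.zero_rpow_le_one (-δ)
  · exact Real.rpow_le_one_of_one_le_of_nonpos (by exact_mod_cast hn) (by linarith)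

theorem zetaDamping_nonneg {δ : ℝ} (hδ : 0 ≤ δ) (i : ℕ ⊕ ℕ) : 0 ≤ zetaDamping δ i := by
  cases i <;> exact (rpow_neg_nonneg_le_one hδ _).1

theorem zetaDamping_le_one {δ : ℝ} (hδ : 0 ≤ δ) (i : ℕ ⊕ ℕ) : zetaDamping δ i ≤ 1 := by
  cases i <;> exact (rpow_neg_nonneg_le_one hδ _).2

theorem summable_recipWeight_mul_rpow {δ : ℝ} (hδ : 0 < δ) :
    Summable fun n : ℕ => recipWeight K n * (n : ℝ) ^ (-δ) := by
  refine Summable.of_nonneg_of_le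
    (fun n => mul_nonneg (recipWeight_nonneg K n) (by positivity)) (fun n => ?_)
    (Real.summable_nat_rpow.2 (show -1 - δ < -1 by linarith))
  rcases Nat.eq_zero_or_pos n with rfl | hn
  · simp; positivity
  · rw [Real.rpow_sub (by positivity), Real.rpow_neg_one, Real.rpow_neg (by positivity),
      ← div_eq_mul_inv]
    gcongr
    exact recipWeight_le K n

/-- The coefficients of `π⁻¹ Re ζ_K(1 + δ + iu)` as a series in `e^{±iu log n}`. -/
noncomputable def zetaCoeff (δ : ℝ) (i : ℕ ⊕ ℕ) : ℝ :=
  zetaWeight K i / (2 * Real.pi) * zetaDamping δ i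

theorem zetaCoeff_nonneg {δ : ℝ} (hδ : 0 ≤ δ) (i : ℕ ⊕ ℕ) : 0 ≤ zetaCoeff K δ i :=
  mul_nonneg (div_nonneg (zetaWeight_nonneg K i) (by have := Real.pi_pos; positivity))
    (zetaDamping_nonneg hδ i)

theorem summable_zetaCoeff {δ : ℝ} (hδ : 0 < δ) : Summable (zetaCoeff K δ) := by
  have h : Summable fun n : ℕ => recipWeight K n / (2 * Real.pi) * (n : ℝ) ^ (-δ) := by
    refine ((summable_recipWeight_mul_rpow K hδ).div_const (2 * Real.pi)).congr fun n => ?_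
    ring
  exact Summable.sum _ h h

theorem re_term_eq (δ u : ℝ) (n : ℕ) :
    (LSeries.term (K.indicator 1) (1 + (δ : ℂ) + Complex.I * (u : ℂ)) n).re =
      recipWeight K n * (n : ℝ) ^ (-δ) * Real.cos (Real.log n * u) := by
  rcases eq_or_ne n 0 with rfl | hn
  · simp
  have hn' : (0 : ℝ) < n := by positivity
  have hnc : (n : ℂ) ≠ 0 := by exact_mod_cast hn
  rw [LSeries.term_of_ne_zero hn]
  by_cases hK : n ∈ K
  · have e : (1 : ℂ) / (n : ℂ) ^ (1 + (δ : ℂ) + Complex.I * (u : ℂ)) =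
        (((n : ℝ)⁻¹ * (n : ℝ) ^ (-δ) : ℝ) : ℂ) *
          Complex.exp ((-(Real.log n * u) : ℝ) * Complex.I) := by
      rw [one_div, ← Complex.cpow_neg, neg_add, neg_add, Complex.cpow_add _ _ hnc,
        Complex.cpow_add _ _ hnc, Complex.cpow_neg_one]
      congr 1
      · rw [Complex.ofReal_mul, Complex.ofReal_cpow hn'.le]
        simp
      · rw [Complex.cpow_def_of_ne_zero hnc, ← Complex.natCast_log]
        congr 1
        push_cast
        ring
    rw [Set.indicator_of_mem hK, Pi.one_apply, e, Complex.re_ofReal_mul,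
      Complex.exp_ofReal_mul_I_re, Real.cos_neg, recipWeight, Set.indicator_of_mem hK]
  · simp [recipWeight, hK]

/-- The real part of each term is a cosine, half the sum of two exponentials; this is where the
frequencies `± log n` and the factor `1/2π` come from. -/
theorem hasSum_re_kZeta {δ : ℝ} (hδ : 0 < δ) (u : ℝ) :
    HasSum (fun i => (zetaCoeff K δ i : ℂ) * Complex.exp (Complex.I * zetaFreq i * u))
      (1 / (Real.pi : ℂ) * ((kZeta K (1 + (δ : ℂ) + Complex.I * (u : ℂ))).re : ℂ)) := by
  have hs : Summable fun i => (zetaCoeff K δ i : ℂ) * Complex.exp (Complex.I * zetaFreq i * u) := by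
    refine Summable.of_norm ((summable_zetaCoeff K hδ).congr fun i => ?_)
    rw [norm_mul, Complex.norm_real, Real.norm_of_nonneg (zetaCoeff_nonneg K hδ.le i),
      Complex.norm_exp]
    simp
  have h1 := (hs.comp_injective Sum.inl_injective).hasSum
  have h2 := (hs.comp_injective Sum.inr_injective).hasSum
  have h3 := h1.add h2
  have h4 : HasSum (fun n => LSeries.term (K.indicator 1) (1 + (δ : ℂ) + Complex.I * (u : ℂ)) n)
      (kZeta K (1 + (δ : ℂ) + Complex.I * (u : ℂ))) :=
    (kZeta_summable K (by simpa using hδ)).hasSum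
  have h5 := (Complex.hasSum_ofReal.2 (Complex.hasSum_re h4)).mul_left (1 / (Real.pi : ℂ))
  have key : ∀ n : ℕ, (zetaCoeff K δ (.inl n) : ℂ) *
        Complex.exp (Complex.I * zetaFreq (.inl n) * u) +
      (zetaCoeff K δ (.inr n) : ℂ) * Complex.exp (Complex.I * zetaFreq (.inr n) * u) =
      1 / (Real.pi : ℂ) *
        ((LSeries.term (K.indicator 1) (1 + (δ : ℂ) + Complex.I * (u : ℂ)) n).re : ℂ) := fun n => by
    rw [re_term_eq]
    simp only [zetaCoeff, zetaWeight, zetaDamping, zetaFreq, Sum.elim_inl, Sum.elim_inr]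
    push_cast
    have hp : (Real.pi : ℂ) ≠ 0 := by exact_mod_cast Real.pi_ne_zero
    rw [Complex.cos]
    have e1 : Complex.log n * u * Complex.I = Complex.I * Complex.log n * u := by ring
    have e2 : -(Complex.log n * u) * Complex.I = Complex.I * -Complex.log n * u := by ring
    rw [e1, e2]
    field_simp
  simp only [Function.comp_apply, key] at h3
  rw [← h3.unique h5]
  exact h1.sum h2

/-- For `δ > 0` the coefficients are absolutely summable, so sum and integral may be exchanged; each
exponential in `t - τ` separates into a factor in `t` and one in `τ`. -/
theorem kZetaIntegral_hasSum {T δ : ℝ} (hδ : 0 < δ) (g : L2Sym T) (t : ℝ) :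
    HasSum (fun i => (zetaCoeff K δ i : ℂ) * Complex.exp (Complex.I * zetaFreq i * t) *
      fourierOn T g (zetaFreq i)) (kZetaIntegral K T δ g t) := by
  have hgi : Integrable g (volume.restrict (Set.Ioo (-T) T)) :=
    (Lp.memLp g).integrable (by norm_num)
  set F : ℕ ⊕ ℕ → ℝ → ℂ := fun i τ => (zetaCoeff K δ i : ℂ) *
    Complex.exp (Complex.I * zetaFreq i * t) * (g τ * Complex.exp (-(Complex.I * zetaFreq i * τ)))
  have hn : ∀ i τ, ‖F i τ‖ = zetaCoeff K δ i * ‖g τ‖ := fun i τ => by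
    simp only [F]
    rw [norm_mul, norm_mul, norm_mul, norm_exp_neg_I_mul, Complex.norm_real,
      Real.norm_of_nonneg (zetaCoeff_nonneg K hδ.le i), Complex.norm_exp]
    simp
  have hi : ∀ i, Integrable (F i) (volume.restrict (Set.Ioo (-T) T)) := fun i =>
    (hgi.norm.const_mul (zetaCoeff K δ i)).mono
      ((hgi.1.mul (Continuous.aestronglyMeasurable (by fun_prop))).const_mul _)
      (Eventually.of_forall fun τ => by
        rw [hn, Real.norm_of_nonneg (mul_nonneg (zetaCoeff_nonneg K hδ.le i) (norm_nonneg _))])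
  have h := hasSum_integral_of_summable_integral_norm hi (by
    simp only [hn, integral_const_mul]
    exact (summable_zetaCoeff K hδ).mul_right _)
  have e : ∫ τ in Set.Ioo (-T) T, ∑' i, F i τ = kZetaIntegral K T δ g t := by
    rw [kZetaIntegral, ← integral_const_mul]
    refine integral_congr_ae (Eventually.of_forall fun τ => ?_)
    have h1 := (hasSum_re_kZeta K hδ (t - τ)).mul_left (g τ)
    have h2 : ∀ i, g τ * ((zetaCoeff K δ i : ℂ) *
        Complex.exp (Complex.I * zetaFreq i * ((t - τ : ℝ) : ℂ))) = F i τ := fun i => by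
      simp only [F]
      have : Complex.exp (Complex.I * zetaFreq i * ((t - τ : ℝ) : ℂ)) =
          Complex.exp (Complex.I * zetaFreq i * t) *
            Complex.exp (-(Complex.I * zetaFreq i * τ)) := by
        rw [← Complex.exp_add]
        push_cast
        ring_nf
      rw [this]
      ring
    simp only [h2] at h1
    simp only [h1.tsum_eq]
    push_cast
    ring
  rw [e] at h
  simp only [F, integral_const_mul] at h
  exact h

theorem inner_expL2_right {T : ℝ} (f : L2Sym T) (ξ : ℝ) :
    inner ℂ f (expL2 T ξ) = ∫ t in Set.Ioo (-T) T,
      Complex.exp (Complex.I * ξ * t) * (starRingEnd ℂ) (f t) := by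
  rw [L2.inner_def]
  refine integral_congr_ae ?_
  filter_upwards [(memLp_exp T ξ).coeFn_toLp] with t ht
  rw [expL2, ht, RCLike.inner_apply]

theorem norm_fourierOn_le (T : ℝ) (g : ℝ → ℂ) (ξ : ℝ) :
    ‖fourierOn T g ξ‖ ≤ ∫ τ in Set.Ioo (-T) T, ‖g τ‖ := by
  refine (norm_integral_le_integral_norm _).trans_eq ?_
  simp only [norm_mul, norm_exp_neg_I_mul, mul_one]

theorem hasSum_inner_kZetaApprox {T δ : ℝ} (hδ : 0 < δ) (f g : L2Sym T) :
    HasSum (fun i => (zetaCoeff K δ i : ℂ) *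
      (inner ℂ f (expL2 T (zetaFreq i)) * inner ℂ (expL2 T (zetaFreq i)) g))
      (inner ℂ f (kZetaApprox K T δ g)) := by
  have hfi : Integrable f (volume.restrict (Set.Ioo (-T) T)) :=
    (Lp.memLp f).integrable (by norm_num)
  set G := ∫ τ in Set.Ioo (-T) T, ‖g τ‖
  have hG : 0 ≤ G := integral_nonneg fun _ => norm_nonneg _
  set F : ℕ ⊕ ℕ → ℝ → ℂ := fun i t => (zetaCoeff K δ i : ℂ) * fourierOn T g (zetaFreq i) *
    (Complex.exp (Complex.I * zetaFreq i * t) * (starRingEnd ℂ) (f t))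
  have hn : ∀ i t, ‖F i t‖ = zetaCoeff K δ i * ‖fourierOn T g (zetaFreq i)‖ * ‖f t‖ :=
    fun i τ => by
      simp only [F]
      rw [norm_mul, norm_mul, norm_mul, RCLike.norm_conj, Complex.norm_real,
        Real.norm_of_nonneg (zetaCoeff_nonneg K hδ.le i), Complex.norm_exp]
      simp
  have hi : ∀ i, Integrable (F i) (volume.restrict (Set.Ioo (-T) T)) := fun i =>
    (hfi.norm.const_mul (zetaCoeff K δ i * ‖fourierOn T g (zetaFreq i)‖)).mono
      (((Continuous.aestronglyMeasurable (by fun_prop)).mul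
        (Complex.continuous_conj.comp_aestronglyMeasurable hfi.1)).const_mul _)
      (Eventually.of_forall fun τ => by
        rw [hn, Real.norm_of_nonneg]
        exact mul_nonneg (mul_nonneg (zetaCoeff_nonneg K hδ.le i) (norm_nonneg _)) (norm_nonneg _))
  have h := hasSum_integral_of_summable_integral_norm hi (by
    simp only [hn, integral_const_mul]
    refine Summable.mul_right _ (Summable.of_nonneg_of_le
      (fun i => mul_nonneg (zetaCoeff_nonneg K hδ.le i) (norm_nonneg _)) (fun i => ?_)
      ((summable_zetaCoeff K hδ).mul_right G))
    exact mul_le_mul_of_nonneg_left (norm_fourierOn_le T g _) (zetaCoeff_nonneg K hδ.le i))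
  have e : ∫ t in Set.Ioo (-T) T, ∑' i, F i t = inner ℂ f (kZetaApprox K T δ g) := by
    rw [L2.inner_def]
    refine integral_congr_ae ?_
    rw [kZetaApprox, dif_pos hδ]
    filter_upwards [(kZetaIntegral_memLp K T hδ g).coeFn_toLp] with t ht
    rw [ht, RCLike.inner_apply]
    have h1 := (kZetaIntegral_hasSum K hδ g t).mul_right ((starRingEnd ℂ) (f t))
    rw [← h1.tsum_eq]
    refine tsum_congr fun i => ?_
    simp only [F]
    ring
  rw [e] at h
  have h2 : ∀ i, ∫ t in Set.Ioo (-T) T, F i t = (zetaCoeff K δ i : ℂ) *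
      (inner ℂ f (expL2 T (zetaFreq i)) * inner ℂ (expL2 T (zetaFreq i)) g) := fun i => by
    simp only [F]
    rw [integral_const_mul, inner_expL2_right, inner_expL2]
    ring
  simpa only [h2] using h

theorem isBessel_zetaDamping {T : ℝ} (hT : 0 < T) {δ : ℝ} (hδ : 0 ≤ δ) :
    IsBessel (fun i => (zetaDamping δ i : ℂ) • weightedExp T (zetaWeight K) zetaFreq i)
      (1 ^ 2 * (2 * (2 * Real.exp (Real.pi / T) / (Real.pi / T) +
        4 * (2 * Real.exp (Real.pi / T)) * T ^ 2 * (Real.pi / T)))) :=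
  (isBessel_zeta K hT).smul fun i => by
    rw [Complex.norm_real, Real.norm_of_nonneg (zetaDamping_nonneg hδ i)]
    exact zetaDamping_le_one hδ i

/-- The factorization `V* D_δ V`: the damping is put on the second family only, so the limit `δ →
0⁺` takes place in `ℓ²`. -/
theorem kZetaApprox_eq {T : ℝ} (hT : 0 < T) {δ : ℝ} (hδ : 0 < δ) (g : L2Sym T) :
    kZetaApprox K T δ g = (isBessel_zeta K hT).analysis.adjoint
      ((isBessel_zetaDamping K hT hδ.le).analysis g) := by
  refine ext_inner_left ℂ fun f => (hasSum_inner_kZetaApprox K hδ f g).unique ?_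
  have h := (isBessel_zeta K hT).hasSum_inner (isBessel_zetaDamping K hT hδ.le) f g
  simp only [inner_smul_left, mul_left_comm _ ((starRingEnd ℂ) _) _,
    inner_mul_inner_weightedExp T (zetaWeight_nonneg K)] at h
  have key : ∀ i, (starRingEnd ℂ) (zetaDamping δ i : ℂ) *
      (((zetaWeight K i / (2 * Real.pi) : ℝ) : ℂ) *
      (inner ℂ f (expL2 T (zetaFreq i)) * inner ℂ (expL2 T (zetaFreq i)) g)) =
      (zetaCoeff K δ i : ℂ) *
      (inner ℂ f (expL2 T (zetaFreq i)) * inner ℂ (expL2 T (zetaFreq i)) g) := fun i => by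
    rw [Complex.conj_ofReal, zetaCoeff]
    push_cast
    ring
  simpa only [key] using h

theorem tendsto_zetaDamping {n : ℕ} (hn : n ≠ 0) :
    Tendsto (fun δ : ℝ => (n : ℝ) ^ (-δ)) (𝓝[>] 0) (𝓝 1) := by
  have h : ContinuousAt (fun δ : ℝ => (n : ℝ) ^ (-δ)) 0 :=
    (Real.continuousAt_const_rpow (by positivity)).comp continuousAt_neg
  have := h.tendsto
  simp only [neg_zero, Real.rpow_zero] at this
  exact this.mono_left nhdsWithin_le_nhds

/-- Dominated convergence in `ℓ²`: each damping factor of nonzero weight tends to one, and `|n^{-δ}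
- 1| ≤ 1` leaves the Bessel sum as majorant. The branch `0` only fills in `δ ≤ 0`, outside the
filter. -/
theorem tendsto_analysis_zetaDamping {T : ℝ} (hT : 0 < T) (g : L2Sym T) :
    Tendsto (fun δ : ℝ => if hδ : 0 < δ then (isBessel_zetaDamping K hT hδ.le).analysis g else 0)
      (𝓝[>] 0) (𝓝 ((isBessel_zeta K hT).analysis g)) := by
  set v := weightedExp T (zetaWeight K) zetaFreq with hv
  have hB := isBessel_zeta K hT
  rw [tendsto_iff_norm_sub_tendsto_zero]
  have h0 : Tendsto (fun δ : ℝ => ∑' i, |zetaDamping δ i - 1| ^ 2 * ‖inner ℂ (v i) g‖ ^ 2)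
      (𝓝[>] 0) (𝓝 (∑' _ : ℕ ⊕ ℕ, (0 : ℝ))) := by
    refine tendsto_tsum_of_dominated_convergence (bound := fun i => ‖inner ℂ (v i) g‖ ^ 2)
      (hB.hasSum_norm_sq g).summable (fun i => ?_) ?_
    · by_cases hw : zetaWeight K i = 0
      · have : inner ℂ (v i) g = 0 := by simp [hv, inner_weightedExp, hw]
        simp [this]
      · have h1 : Tendsto (fun δ => zetaDamping δ i) (𝓝[>] 0) (𝓝 1) := by
          cases i with
          | inl n =>
            exact tendsto_zetaDamping fun hn => hw (by simp [zetaWeight, hn])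
          | inr n =>
            exact tendsto_zetaDamping fun hn => hw (by simp [zetaWeight, hn])
        have h2 := (((h1.sub_const 1).abs).pow 2).mul_const (‖inner ℂ (v i) g‖ ^ 2)
        simpa using h2
    · filter_upwards [self_mem_nhdsWithin] with δ hδ i
      have hδ' : 0 ≤ δ := (Set.mem_Ioi.1 hδ).le
      rw [Real.norm_of_nonneg (by positivity)]
      refine mul_le_of_le_one_left (by positivity) ?_
      have h1 := zetaDamping_nonneg hδ' i
      have h2 := zetaDamping_le_one hδ' i
      have : |zetaDamping δ i - 1| ≤ 1 := abs_le.2 ⟨by linarith, by linarith⟩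
      exact pow_le_one₀ (abs_nonneg _) this
  rw [tsum_zero] at h0
  have h1 := (Real.continuous_sqrt.tendsto _).comp h0
  rw [Real.sqrt_zero] at h1
  refine h1.congr' ?_
  filter_upwards [self_mem_nhdsWithin] with δ hδ
  have hδ' : 0 < δ := hδ
  rw [Function.comp_apply, dif_pos hδ', ← Real.sqrt_sq (norm_nonneg _)]
  congr 1
  have h2 := lp.hasSum_norm (by norm_num)
    ((isBessel_zetaDamping K hT hδ'.le).analysis g - hB.analysis g)
  have h3 : HasSum (fun i => |zetaDamping δ i - 1| ^ 2 * ‖inner ℂ (v i) g‖ ^ 2)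
      (‖(isBessel_zetaDamping K hT hδ'.le).analysis g - hB.analysis g‖ ^ 2) := by
    have key : ∀ i, ‖((isBessel_zetaDamping K hT hδ'.le).analysis g - hB.analysis g) i‖ ^ 2 =
        |zetaDamping δ i - 1| ^ 2 * ‖inner ℂ (v i) g‖ ^ 2 := fun i => by
      have : ((isBessel_zetaDamping K hT hδ'.le).analysis g - hB.analysis g) i =
          ((zetaDamping δ i - 1 : ℝ) : ℂ) * inner ℂ (v i) g := by
        rw [lp.coeFn_sub, Pi.sub_apply, IsBessel.analysis_apply, IsBessel.analysis_apply,
          inner_smul_left, Complex.conj_ofReal]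
        push_cast
        ring
      rw [this, norm_mul, mul_pow, Complex.norm_real, Real.norm_eq_abs]
    have h4 : HasSum
        (fun i => ‖((isBessel_zetaDamping K hT hδ'.le).analysis g - hB.analysis g) i‖ ^ 2)
        (‖(isBessel_zetaDamping K hT hδ'.le).analysis g - hB.analysis g‖ ^ 2) := by
      simpa using h2
    simp only [key] at h4
    exact h4
  exact h3.tsum_eq

theorem isKZetaOperator_frame {T : ℝ} (hT : 0 < T) :
    IsKZetaOperator K T
      ((isBessel_zeta K hT).analysis.adjoint ∘L (isBessel_zeta K hT).analysis) := by
  intro g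
  have h := ((isBessel_zeta K hT).analysis.adjoint.continuous.tendsto _).comp
    (tendsto_analysis_zetaDamping K hT g)
  refine h.congr' ?_
  filter_upwards [self_mem_nhdsWithin] with δ hδ
  rw [Function.comp_apply, dif_pos (show 0 < δ from hδ), kZetaApprox_eq K hT hδ]

theorem isKZetaOperator_kZetaOperator {T : ℝ} (hT : 0 < T) :
    IsKZetaOperator K T (kZetaOperator K T) := by
  have h : ∃ Z : L2Sym T →L[ℂ] L2Sym T, IsKZetaOperator K T Z := ⟨_, isKZetaOperator_frame K hT⟩
  rw [kZetaOperator, dif_pos h]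
  exact h.choose_spec

theorem kZetaOperator_eq {T : ℝ} (hT : 0 < T) :
    kZetaOperator K T =
      (isBessel_zeta K hT).analysis.adjoint ∘L (isBessel_zeta K hT).analysis :=
  (isKZetaOperator_kZetaOperator K hT).unique (isKZetaOperator_frame K hT)

/-- The node operators minus `A` are compact for every lattice and converge in norm to `Z - A` as
the lattice is refined. -/
theorem isCompactOperator_of_density {A : ℝ}
    (hK : Tendsto (fun x : ℝ => (kCount K x : ℝ) / x) atTop (𝓝 A)) {T : ℝ} (hT : 0 < T) :
    IsCompactOperator (kZetaOperator K T - (A : ℂ) • ContinuousLinearMap.id ℂ (L2Sym T)) := by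
  have hp := Real.pi_pos
  set V := (isBessel_zeta K hT).analysis with hV
  set h : ℕ → ℝ := fun m => Real.pi / (T * (m + 1 : ℕ)) with hh
  have h0 : ∀ m, 0 < h m := fun m => by positivity
  have hW := fun m => isBessel_weightedExp_node hT m.succ_ne_zero (h := h m) rfl
    (zetaWeight_nonneg K) (sum_zetaWeight_le K (h0 m))
  have hR := fun m => isBessel_weightedExp_sub_node hT m.succ_ne_zero (h := h m) rfl
    (zetaWeight_nonneg K) (sum_zetaWeight_le K (h0 m)) (abs_zetaFreq_sub_le (h0 m))
  have hlim : Tendsto h atTop (𝓝 0) := by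
    have := (tendsto_one_div_add_atTop_nhds_zero_nat (𝕜 := ℝ)).const_mul (Real.pi / T)
    rw [mul_zero] at this
    refine this.congr fun m => ?_
    simp only [hh]
    push_cast
    field_simp
  refine isCompactOperator_of_tendsto (l := atTop)
    (F := fun m => (hW m).analysis.adjoint ∘L (hW m).analysis -
      (A : ℂ) • ContinuousLinearMap.id ℂ (L2Sym T)) ?_
    (Eventually.of_forall fun m => isCompactOperator_node_sub hT m.succ_ne_zero rfl
      (zetaWeight_nonneg K) (sum_zetaWeight_le K (h0 m)) (hW m)
      (hasSum_zetaWeight_fiber K (h0 m)) (tendsto_blockWeight K hK (h0 m)))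
  refine Tendsto.sub_const ?_ _
  rw [tendsto_iff_norm_sub_tendsto_zero]
  -- The weight bound `2e^h` per node stays bounded, so the norm of the perturbation is `O(√h)`.
  have hRlim : Tendsto (fun m => √(4 * (2 * Real.exp (h m)) * T ^ 2 * h m)) atTop (𝓝 0) := by
    have hc : Continuous fun x : ℝ => √(4 * (2 * Real.exp x) * T ^ 2 * x) := by fun_prop
    have := (hc.tendsto 0).comp hlim
    simpa [Function.comp_def] using this
  have hlim2 := (hRlim.const_mul (2 * ‖V‖)).add (hRlim.pow 2)
  simp only [mul_zero, ne_eq, OfNat.ofNat_ne_zero, not_false_eq_true, zero_pow, add_zero] at hlim2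
  refine squeeze_zero (fun _ => norm_nonneg _) (fun m => ?_) hlim2
  have e : (hW m).analysis = V - (hR m).analysis :=
    IsBessel.analysis_sub (isBessel_zeta K hT) (hW m) (hR m)
  rw [kZetaOperator_eq K hT, norm_sub_rev, e]
  refine (norm_adjoint_comp_self_sub_le V (hR m).analysis).trans ?_
  have := (hR m).norm_analysis_le
  gcongr

end ZetaOperator

open scoped ENNReal

/-! ### Weakly null exponentials and compact operators. -/

section WeaklyNull

/-- The images stay in a compact set, and weak convergence, transported through the adjoint, makes
every cluster point orthogonal to all vectors. Stated for a filter since the parameter `x` is real.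
-/
theorem tendsto_zero_of_isCompactOperator {H : Type*} [NormedAddCommGroup H]
    [InnerProductSpace ℂ H] [CompleteSpace H] {S : H →L[ℂ] H} (hS : IsCompactOperator S)
    {α : Type*} {l : Filter α} {e : α → H} {M : ℝ} (hM : ∀ x, ‖e x‖ ≤ M)
    (hw : ∀ f, Tendsto (fun x => inner ℂ f (e x)) l (𝓝 0)) :
    Tendsto (fun x => S (e x)) l (𝓝 0) := by
  obtain ⟨C, hC, hSC⟩ := hS.image_closedBall_subset_compact (M₂ := H) (f := (S : H →ₗ[ℂ] H)) M
  refine hC.tendsto_nhds_of_unique_mapClusterPt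
    (Eventually.of_forall fun x => hSC ⟨e x, by simpa using hM x, rfl⟩) fun y _ hy => ?_
  refine ext_inner_left ℂ fun f => ?_
  rw [inner_zero_right]
  have h1 : MapClusterPt (inner ℂ f y) l (fun x => inner ℂ f (S (e x))) :=
    hy.continuousAt_comp (f := fun z => inner ℂ f z) (by fun_prop)
  have h2 : Tendsto (fun x => inner ℂ f (S (e x))) l (𝓝 0) := by
    simpa only [ContinuousLinearMap.adjoint_inner_left] using hw (S.adjoint f)
  have h3 : (𝓝 (inner ℂ f y) ⊓ 𝓝 (0 : ℂ)).NeBot := by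
    have : ClusterPt (inner ℂ f y) (map (fun x => inner ℂ f (S (e x))) l) := h1
    exact this.mono h2
  exact eq_of_nhds_neBot h3

/-- Riemann–Lebesgue, after rescaling the frequency by `2π`. -/
theorem tendsto_fourierOn_atTop (T : ℝ) (g : ℝ → ℂ) :
    Tendsto (fourierOn T g) atTop (𝓝 0) := by
  have h := Real.tendsto_integral_exp_smul_cocompact ((Set.Ioo (-T) T).indicator g)
  have hs : Tendsto (fun ξ : ℝ => ξ / (2 * Real.pi)) atTop (cocompact ℝ) :=
    (tendsto_id.atTop_div_const (by have := Real.pi_pos; positivity)).mono_right atTop_le_cocompact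
  refine (h.comp hs).congr fun ξ => ?_
  have hp : (Real.pi : ℂ) ≠ 0 := by exact_mod_cast Real.pi_ne_zero
  rw [Function.comp_apply, fourierOn, ← integral_indicator measurableSet_Ioo]
  congr 1
  ext τ
  by_cases hτ : τ ∈ Set.Ioo (-T) T
  · simp only [Set.indicator_of_mem hτ, Circle.smul_def, Real.fourierChar_apply, smul_eq_mul]
    rw [mul_comm]
    congr 2
    push_cast
    field_simp
  · simp only [Set.indicator_of_notMem hτ, smul_zero]

theorem tendsto_inner_expL2 {T : ℝ} (f : L2Sym T) :
    Tendsto (fun ξ => inner ℂ f (expL2 T ξ)) atTop (𝓝 0) := by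
  have := (Complex.continuous_conj.tendsto _).comp (tendsto_fourierOn_atTop T f)
  rw [map_zero] at this
  refine this.congr fun ξ => ?_
  rw [Function.comp_apply, ← inner_expL2, inner_conj_symm]

theorem inner_expL2_expL2 (T x y : ℝ) :
    inner ℂ (expL2 T x) (expL2 T y) = fourierOn T (fun _ => 1) (x - y) := by
  rw [inner_expL2, fourierOn, fourierOn]
  refine integral_congr_ae ?_
  filter_upwards [(memLp_exp T y).coeFn_toLp] with t ht
  rw [expL2, ht, ← Complex.exp_add, one_mul]
  push_cast
  ring_nf

theorem norm_sq_expL2 {T : ℝ} (hT : 0 < T) (x : ℝ) : ‖expL2 T x‖ ^ 2 = 2 * T := by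
  have h := inner_self_eq_norm_sq_to_K (𝕜 := ℂ) (expL2 T x)
  rw [inner_expL2_expL2, sub_self, fourierOn] at h
  simp only [Complex.ofReal_zero, mul_zero, zero_mul, neg_zero, Complex.exp_zero, mul_one,
    integral_const, Measure.real, Measure.restrict_apply_univ, Real.volume_Ioo] at h
  rw [ENNReal.toReal_ofReal (by linarith), Complex.real_smul, mul_one] at h
  have h' : ((T - -T : ℝ) : ℂ) = ((‖expL2 T x‖ ^ 2 : ℝ) : ℂ) := by rw [h]; simp
  have := Complex.ofReal_injective h'
  linarith

end WeaklyNull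

/-! ### The Fejér kernel: mass one and concentration at the origin. -/

section Fejer

/-- The Fejér kernel `(πT)⁻¹ (sin (Tx) / x)²`. -/
noncomputable def fejer (T x : ℝ) : ℝ := ‖fourierOn T (fun _ => 1) x‖ ^ 2 / (4 * Real.pi * T)

theorem fejer_nonneg {T : ℝ} (hT : 0 < T) (x : ℝ) : 0 ≤ fejer T x := by
  have := Real.pi_pos
  unfold fejer
  positivity

theorem memLp_one (T : ℝ) : MemLp (fun _ : ℝ => (1 : ℂ)) 2 (volume.restrict (Set.Ioo (-T) T)) :=
  memLp_const 1

theorem continuous_fejer (T : ℝ) : Continuous (fejer T) := by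
  have := continuous_fourierOn ((memLp_one T).integrable (by norm_num))
  unfold fejer
  fun_prop

/-- Parseval for the constant function `1`: the periodization of the kernel with period `π/T` is
constant. -/
theorem hasSum_fejer {T : ℝ} (hT : 0 < T) (u : ℝ) :
    HasSum (fun j : ℤ => fejer T (j * (Real.pi / T) + u)) (T / Real.pi) := by
  have h := (hasSum_norm_sq_fourierOn_add hT one_ne_zero (memLp_one T) (h := Real.pi / T)
    (by simp) u).div_const (4 * Real.pi * T)
  have hp := Real.pi_pos
  have e : (2 * Real.pi / (Real.pi / T) * ∫ _ in Set.Ioo (-T) T, ‖(1 : ℂ)‖ ^ 2) /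
      (4 * Real.pi * T) = T / Real.pi := by
    simp only [norm_one, one_pow, integral_const, Measure.real, Measure.restrict_apply_univ,
      Real.volume_Ioo, smul_eq_mul, mul_one]
    rw [ENNReal.toReal_ofReal (by linarith)]
    field_simp
    ring
  rwa [e] at h

/-- Cut the line into periods of length `π/T` and use that the periodization equals `T/π`. -/
theorem lintegral_fejer {T : ℝ} (hT : 0 < T) : ∫⁻ u, ENNReal.ofReal (fejer T u) = 1 := by
  have hp := Real.pi_pos
  have hh : 0 < Real.pi / T := by positivity
  have hm : ∀ j : ℤ, Measurable fun u => ENNReal.ofReal (fejer T (j * (Real.pi / T) + u)) :=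
    fun j => (ENNReal.continuous_ofReal.comp
      ((continuous_fejer T).comp (by fun_prop))).measurable
  calc ∫⁻ u, ENNReal.ofReal (fejer T u)
      = ∑' j : ℤ, ∫⁻ u in Set.Ioc (j • (Real.pi / T)) ((j + 1) • (Real.pi / T)),
          ENNReal.ofReal (fejer T u) := by
        rw [← setLIntegral_univ, ← iUnion_Ioc_zsmul hh,
          lintegral_iUnion (fun _ => measurableSet_Ioc) (by
            simpa using Set.pairwise_disjoint_Ioc_zsmul (Real.pi / T))]
    _ = ∑' j : ℤ, ∫⁻ u in Set.Ioc 0 (Real.pi / T),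
          ENNReal.ofReal (fejer T (j * (Real.pi / T) + u)) := by
        refine tsum_congr fun j => ?_
        have e : Set.Ioc 0 (Real.pi / T) = (fun u => j * (Real.pi / T) + u) ⁻¹'
            Set.Ioc (j • (Real.pi / T)) ((j + 1) • (Real.pi / T)) := by
          ext u
          simp only [Set.mem_preimage, Set.mem_Ioc, zsmul_eq_mul]
          push_cast
          constructor <;> rintro ⟨h1, h2⟩ <;> constructor <;> linarith
        rw [e]
        exact ((measurePreserving_add_left volume _).setLIntegral_comp_preimage_emb
          (measurableEmbedding_addLeft _) (fun u => ENNReal.ofReal (fejer T u)) _).symm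
    _ = ∫⁻ u in Set.Ioc 0 (Real.pi / T), ENNReal.ofReal (T / Real.pi) := by
        rw [← lintegral_tsum fun j => (hm j).aemeasurable]
        refine lintegral_congr fun u => ?_
        rw [← (hasSum_fejer hT u).tsum_eq,
          ENNReal.ofReal_tsum_of_nonneg (fun _ => fejer_nonneg hT _) (hasSum_fejer hT u).summable]
    _ = 1 := by
        rw [setLIntegral_const, Real.volume_Ioc, sub_zero, ← ENNReal.ofReal_mul (by positivity)]
        have : T / Real.pi * (Real.pi / T) = 1 := by field_simp
        rw [this, ENNReal.ofReal_one]

theorem norm_fourierOn_one_le {T : ℝ} (hT : 0 < T) {x : ℝ} (hx : x ≠ 0) :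
    ‖fourierOn T (fun _ => 1) x‖ ≤ 2 / |x| := by
  have hc : -(Complex.I * x) ≠ 0 := by simpa using hx
  have e : fourierOn T (fun _ => 1) x =
      (Complex.exp (-(Complex.I * x) * T) - Complex.exp (-(Complex.I * x) * (-T : ℝ))) /
        -(Complex.I * x) := by
    rw [← integral_exp_mul_complex hc, intervalIntegral.integral_of_le (by linarith),
      integral_Ioc_eq_integral_Ioo, fourierOn]
    refine integral_congr_ae (Eventually.of_forall fun τ => ?_)
    simp
  rw [e, norm_div, norm_neg, norm_mul, Complex.norm_I, one_mul, Complex.norm_real,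
    Real.norm_eq_abs]
  gcongr
  refine (norm_sub_le _ _).trans_eq ?_
  rw [Complex.norm_exp, Complex.norm_exp]
  norm_num

/-- The kernel is at most `1/(πTu²)`. Away from `[-ε, ε]` this is dominated by a multiple of
`1/(1+u²)`, whose integral `π` is explicit; for fixed `ε` the tail is `O(1/T)`. -/
theorem lintegral_fejer_tail_le {T : ℝ} (hT : 0 < T) {ε : ℝ} (hε : 0 < ε) :
    ∫⁻ u in (Set.Icc (-ε) ε)ᶜ, ENNReal.ofReal (fejer T u) ≤
      ENNReal.ofReal ((1 + (ε ^ 2)⁻¹) / T) := by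
  have hp := Real.pi_pos
  set c := (1 + (ε ^ 2)⁻¹) / (Real.pi * T) with hc
  have hc0 : 0 ≤ c := by positivity
  calc ∫⁻ u in (Set.Icc (-ε) ε)ᶜ, ENNReal.ofReal (fejer T u)
      ≤ ∫⁻ u in (Set.Icc (-ε) ε)ᶜ, ENNReal.ofReal (c * (1 + u ^ 2)⁻¹) := by
        refine setLIntegral_mono (by fun_prop) fun u hu => ENNReal.ofReal_le_ofReal ?_
        have hu' : ε < |u| := by
          by_contra! h
          exact hu (abs_le.1 h)
        have hu0 : u ≠ 0 := abs_pos.1 (hε.trans hu')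
        have h1 : ε ^ 2 ≤ u ^ 2 := by
          rw [← sq_abs u]; gcongr
        have h2 : ‖fourierOn T (fun _ => 1) u‖ ^ 2 ≤ 4 / u ^ 2 := by
          refine (pow_le_pow_left₀ (norm_nonneg _) (norm_fourierOn_one_le hT hu0) 2).trans_eq ?_
          rw [div_pow, sq_abs]; norm_num
        have h3 : 4 / u ^ 2 ≤ 4 * ((1 + (ε ^ 2)⁻¹) * (1 + u ^ 2)⁻¹) := by
          have hu2 : 0 < u ^ 2 := by positivity
          have : 1 ≤ (ε ^ 2)⁻¹ * u ^ 2 := by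
            rw [inv_mul_eq_div, one_le_div (by positivity)]; exact h1
          rw [← div_eq_mul_inv, ← mul_div_assoc, div_le_div_iff₀ hu2 (by positivity)]
          linarith
        calc fejer T u ≤ 4 * ((1 + (ε ^ 2)⁻¹) * (1 + u ^ 2)⁻¹) / (4 * Real.pi * T) := by
              unfold fejer
              gcongr
              exact h2.trans h3
          _ = c * (1 + u ^ 2)⁻¹ := by rw [hc]; field_simp
    _ ≤ ∫⁻ u, ENNReal.ofReal (c * (1 + u ^ 2)⁻¹) := setLIntegral_le_lintegral _ _
    _ = ENNReal.ofReal (∫ u, c * (1 + u ^ 2)⁻¹) := by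
        rw [ofReal_integral_eq_lintegral_ofReal (integrable_inv_one_add_sq.const_mul c)
          (Eventually.of_forall fun u => by positivity)]
    _ = _ := by
        rw [integral_const_mul, integral_univ_inv_one_add_sq, hc]
        congr 1
        field_simp

end Fejer

/-! ### Quadratic forms of the operator at exponentials. -/

section FejerAverage

variable (K : Set ℕ)

/-- The Fejér average `∑ w_i F_T(x - ξ_i)` of the frequency measure. -/
theorem hasSum_fejerAverage {T : ℝ} (hT : 0 < T) (x : ℝ) :
    HasSum (fun i => zetaWeight K i * fejer T (x - zetaFreq i))
      ((inner ℂ (expL2 T x) (kZetaOperator K T (expL2 T x))).re / (2 * T)) := by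
  have hp := Real.pi_pos
  have h := ((isBessel_zeta K hT).hasSum_norm_sq (expL2 T x)).div_const (2 * T)
  have e : (inner ℂ (expL2 T x) (kZetaOperator K T (expL2 T x))).re =
      ‖(isBessel_zeta K hT).analysis (expL2 T x)‖ ^ 2 := by
    rw [kZetaOperator_eq K hT, ContinuousLinearMap.comp_apply,
      ContinuousLinearMap.adjoint_inner_right, inner_self_eq_norm_sq_to_K]
    norm_cast
  rw [e]
  have key : ∀ i, ‖inner ℂ (weightedExp T (zetaWeight K) zetaFreq i) (expL2 T x)‖ ^ 2 / (2 * T) =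
      zetaWeight K i * fejer T (x - zetaFreq i) := fun i => by
    rw [inner_weightedExp, norm_sqrt_mul_sq (zetaWeight_nonneg K i), ← inner_expL2,
      norm_inner_symm, inner_expL2_expL2, fejer]
    field_simp
    ring
  simpa only [key] using h

/-- Uniform in `x`: it provides both the boundedness and the integrable majorant used in the
Tauberian step. -/
theorem fejerAverage_le {T : ℝ} (hT : 0 < T) (x : ℝ) :
    (inner ℂ (expL2 T x) (kZetaOperator K T (expL2 T x))).re / (2 * T) ≤
      ‖kZetaOperator K T‖ := by
  rw [div_le_iff₀ (by positivity), ← norm_sq_expL2 hT x]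
  calc (inner ℂ (expL2 T x) (kZetaOperator K T (expL2 T x))).re
      ≤ ‖expL2 T x‖ * ‖kZetaOperator K T (expL2 T x)‖ :=
        (Complex.re_le_norm _).trans (norm_inner_le_norm _ _)
    _ ≤ ‖expL2 T x‖ * (‖kZetaOperator K T‖ * ‖expL2 T x‖) := by
        gcongr
        exact (kZetaOperator K T).le_opNorm _
    _ = _ := by ring

/-- The exponentials are weakly null of constant norm `√(2T)`, so the compact operator `Z - A` sends
them to zero and its quadratic form vanishes in the limit. -/
theorem tendsto_fejerAverage {A T : ℝ} (hT : 0 < T)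
    (hc : IsCompactOperator (kZetaOperator K T - (A : ℂ) • ContinuousLinearMap.id ℂ (L2Sym T))) :
    Tendsto (fun x => (inner ℂ (expL2 T x) (kZetaOperator K T (expL2 T x))).re / (2 * T)) atTop
      (𝓝 A) := by
  have hn : ∀ x, ‖expL2 T x‖ = √(2 * T) := fun x => by
    rw [← norm_sq_expL2 hT x, Real.sqrt_sq (norm_nonneg _)]
  set S := kZetaOperator K T - (A : ℂ) • ContinuousLinearMap.id ℂ (L2Sym T) with hS
  have h := tendsto_zero_of_isCompactOperator hc (fun x => (hn x).le)
    (fun f => tendsto_inner_expL2 f)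
  have h1 : Tendsto (fun x => inner ℂ (expL2 T x) (S (expL2 T x))) atTop (𝓝 0) := by
    refine squeeze_zero_norm (a := fun x => √(2 * T) * ‖S (expL2 T x)‖) (fun x => ?_) ?_
    · rw [← hn x]; exact norm_inner_le_norm _ _
    · simpa using h.norm.const_mul (√(2 * T))
  have h2 := (((Complex.continuous_re.tendsto _).comp h1).div_const (2 * T)).add_const A
  simp only [Complex.zero_re, zero_div, zero_add] at h2
  refine h2.congr fun x => ?_
  have e : inner ℂ (expL2 T x) (S (expL2 T x)) =
      inner ℂ (expL2 T x) (kZetaOperator K T (expL2 T x)) - ((A * (2 * T) : ℝ) : ℂ) := by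
    have : S (expL2 T x) = kZetaOperator K T (expL2 T x) - (A : ℂ) • expL2 T x := rfl
    rw [this, inner_sub_right, inner_smul_right, inner_self_eq_norm_sq_to_K, ← norm_sq_expL2 hT x]
    push_cast
    rfl
  rw [Function.comp_apply, e, Complex.sub_re, Complex.ofReal_re]
  field_simp
  ring

end FejerAverage

/-! ### The Tauberian theorem. -/

section Tauberian

variable {b : ℝ → ℝ≥0∞}

/-- A function that decreases at most exponentially and whose Fejér averages tend to `A`
tends to `A`. -/
theorem tendsto_of_tendsto_fejerAverage (hbm : Measurable b)
    (hmono : ∀ x u, 0 ≤ u → b x ≤ ENNReal.ofReal (Real.exp u) * b (x + u)) {A : ℝ} (hA : 0 ≤ A)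
    (hbdd : ∀ T, 0 < T → ∃ M : ℝ, ∀ x, ∫⁻ u, ENNReal.ofReal (fejer T u) * b (x - u) ≤
      ENNReal.ofReal M)
    (hlim : ∀ T, 0 < T → Tendsto (fun x => ∫⁻ u, ENNReal.ofReal (fejer T u) * b (x - u)) atTop
      (𝓝 (ENNReal.ofReal A))) :
    Tendsto (fun x => (b x).toReal) atTop (𝓝 A) := by
  set Φ : ℝ → ℝ → ℝ≥0∞ := fun T x => ∫⁻ u, ENNReal.ofReal (fejer T u) * b (x - u) with hΦ
  have hfm : ∀ T, Measurable fun u => ENNReal.ofReal (fejer T u) := fun T =>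
    (ENNReal.continuous_ofReal.comp (continuous_fejer T)).measurable
  have hΦtop : ∀ T, 0 < T → ∀ x, Φ T x ≠ ∞ := fun T hT x => by
    obtain ⟨M, hM⟩ := hbdd T hT
    exact ((hM x).trans_lt ENNReal.ofReal_lt_top).ne
  have hmass : ∀ T ε, 0 < T → 0 < ε → 1 ≤ (∫⁻ u in Set.Icc (-ε) ε, ENNReal.ofReal (fejer T u)) +
      ENNReal.ofReal ((1 + (ε ^ 2)⁻¹) / T) := fun T ε hT hε => by
    rw [← lintegral_fejer hT, ← lintegral_add_compl _ (measurableSet_Icc (a := -ε) (b := ε))]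
    gcongr
    exact lintegral_fejer_tail_le hT hε
  -- For `|u| ≤ ε` the point `x + ε - u` lies at most `2ε` to the right of `x`; centring the average
  -- at `x + ε` makes the one-sided growth condition applicable on the whole window.
  have hup : ∀ T ε, 0 < T → 0 < ε → ∀ x,
      (∫⁻ u in Set.Icc (-ε) ε, ENNReal.ofReal (fejer T u)) * b x ≤
        ENNReal.ofReal (Real.exp (2 * ε)) * Φ T (x + ε) := fun T ε hT hε x => by
    rw [← lintegral_mul_const _ (hfm T), ← lintegral_const_mul _ (by fun_prop)]
    refine (setLIntegral_mono (by fun_prop) fun u hu => ?_).trans (setLIntegral_le_lintegral _ _)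
    rw [mul_left_comm]
    gcongr
    have h := hmono x (ε - u) (by linarith [hu.2])
    rw [show x + (ε - u) = x + ε - u by ring] at h
    refine h.trans ?_
    gcongr
    linarith [hu.1]
  obtain ⟨M, hM0, hM⟩ : ∃ M : ℝ, 0 ≤ M ∧ ∀ x, b x ≤ ENNReal.ofReal M := by
    -- With `T = 4` and `ε = 1` the tail bound is `1/2`, so the window carries at least half the
    -- mass and `b` is bounded.
    obtain ⟨M, hM⟩ := hbdd 4 (by norm_num)
    refine ⟨2 * (Real.exp 2 * max M 0), by positivity, fun x => ?_⟩
    have h1 := hmass 4 1 (by norm_num) one_pos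
    have h2 := hup 4 1 (by norm_num) one_pos x
    set J := ∫⁻ u in Set.Icc (-1 : ℝ) 1, ENNReal.ofReal (fejer 4 u)
    have h3 : (2⁻¹ : ℝ≥0∞) ≤ J := by
      have e : ENNReal.ofReal ((1 + ((1 : ℝ) ^ 2)⁻¹) / 4) = 2⁻¹ := by
        rw [show ((1 + ((1 : ℝ) ^ 2)⁻¹) / 4) = 2⁻¹ by norm_num,
          ENNReal.ofReal_inv_of_pos two_pos]
        norm_num
      rw [e] at h1
      have := tsub_le_iff_right.2 h1
      rwa [ENNReal.one_sub_inv_two] at this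
    have h4 : 2⁻¹ * b x ≤ ENNReal.ofReal (Real.exp 2 * max M 0) := by
      refine (mul_le_mul_left h3 (b x)).trans (h2.trans ?_)
      rw [ENNReal.ofReal_mul (Real.exp_pos _).le, mul_one]
      gcongr
      exact (hM _).trans (ENNReal.ofReal_le_ofReal (le_max_left _ _))
    rw [ENNReal.ofReal_mul two_pos.le]
    calc b x = 2 * (2⁻¹ * b x) := by
          rw [← mul_assoc, ENNReal.mul_inv_cancel two_ne_zero ENNReal.ofNat_ne_top, one_mul]
      _ ≤ ENNReal.ofReal 2 * ENNReal.ofReal (Real.exp 2 * max M 0) := by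
          gcongr
          simp
  have hbtop : ∀ x, b x ≠ ∞ := fun x => ((hM x).trans_lt ENNReal.ofReal_lt_top).ne
  -- Passing to real numbers and absorbing the tail term on the left requires `b x` to be finite,
  -- hence the boundedness first.
  have hupR : ∀ T ε, 0 < T → 0 < ε → ∀ x, (1 - (1 + (ε ^ 2)⁻¹) / T) * (b x).toReal ≤
      Real.exp (2 * ε) * (Φ T (x + ε)).toReal := fun T ε hT hε x => by
    have h1 : b x ≤ ENNReal.ofReal (Real.exp (2 * ε)) * Φ T (x + ε) +
        ENNReal.ofReal ((1 + (ε ^ 2)⁻¹) / T) * b x := by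
      calc b x ≤ ((∫⁻ u in Set.Icc (-ε) ε, ENNReal.ofReal (fejer T u)) +
            ENNReal.ofReal ((1 + (ε ^ 2)⁻¹) / T)) * b x :=
            le_mul_of_one_le_left zero_le (hmass T ε hT hε)
        _ ≤ _ := by
            rw [add_mul]
            exact add_le_add (hup T ε hT hε x) le_rfl
    have hf1 : ENNReal.ofReal (Real.exp (2 * ε)) * Φ T (x + ε) ≠ ∞ :=
      ENNReal.mul_ne_top ENNReal.ofReal_ne_top (hΦtop T hT _)
    have hf2 : ENNReal.ofReal ((1 + (ε ^ 2)⁻¹) / T) * b x ≠ ∞ :=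
      ENNReal.mul_ne_top ENNReal.ofReal_ne_top (hbtop x)
    have h2 := ENNReal.toReal_mono (ENNReal.add_ne_top.2 ⟨hf1, hf2⟩) h1
    rw [ENNReal.toReal_add hf1 hf2, ENNReal.toReal_mul, ENNReal.toReal_mul,
      ENNReal.toReal_ofReal (Real.exp_pos _).le, ENNReal.toReal_ofReal (by positivity)] at h2
    linarith
  -- The mirror estimate: the average centred at `x - ε` sees only points left of `x` in the window,
  -- and the tail is controlled by the bound `M`.
  have hloR : ∀ T ε, 0 < T → 0 < ε → ∀ x, (Φ T (x - ε)).toReal ≤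
      Real.exp (2 * ε) * (b x).toReal + (1 + (ε ^ 2)⁻¹) / T * M := fun T ε hT hε x => by
    have h1 : Φ T (x - ε) ≤ ENNReal.ofReal (Real.exp (2 * ε)) * b x +
        ENNReal.ofReal ((1 + (ε ^ 2)⁻¹) / T) * ENNReal.ofReal M := by
      rw [hΦ]
      simp only
      rw [← lintegral_add_compl _ (measurableSet_Icc (a := -ε) (b := ε))]
      gcongr
      · calc ∫⁻ u in Set.Icc (-ε) ε, ENNReal.ofReal (fejer T u) * b (x - ε - u)
            ≤ ∫⁻ u in Set.Icc (-ε) ε, ENNReal.ofReal (fejer T u) *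
                (ENNReal.ofReal (Real.exp (2 * ε)) * b x) := by
              refine setLIntegral_mono (by fun_prop) fun u hu => ?_
              gcongr
              have h := hmono (x - ε - u) (ε + u) (by linarith [hu.1])
              rw [show x - ε - u + (ε + u) = x by ring] at h
              refine h.trans ?_
              gcongr
              linarith [hu.2]
          _ ≤ ∫⁻ u, ENNReal.ofReal (fejer T u) * (ENNReal.ofReal (Real.exp (2 * ε)) * b x) :=
              setLIntegral_le_lintegral _ _
          _ = _ := by rw [lintegral_mul_const _ (hfm T), lintegral_fejer hT, one_mul]
      · calc ∫⁻ u in (Set.Icc (-ε) ε)ᶜ, ENNReal.ofReal (fejer T u) * b (x - ε - u)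
            ≤ ∫⁻ u in (Set.Icc (-ε) ε)ᶜ, ENNReal.ofReal (fejer T u) * ENNReal.ofReal M :=
              lintegral_mono fun u => by gcongr; exact hM _
          _ ≤ _ := by
              rw [lintegral_mul_const _ (hfm T)]
              gcongr
              exact lintegral_fejer_tail_le hT hε
    have hf1 : ENNReal.ofReal (Real.exp (2 * ε)) * b x ≠ ∞ :=
      ENNReal.mul_ne_top ENNReal.ofReal_ne_top (hbtop x)
    have hf2 : ENNReal.ofReal ((1 + (ε ^ 2)⁻¹) / T) * ENNReal.ofReal M ≠ ∞ :=
      ENNReal.mul_ne_top ENNReal.ofReal_ne_top ENNReal.ofReal_ne_top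
    have h2 := ENNReal.toReal_mono (ENNReal.add_ne_top.2 ⟨hf1, hf2⟩) h1
    rwa [ENNReal.toReal_add hf1 hf2, ENNReal.toReal_mul, ENNReal.toReal_mul,
      ENNReal.toReal_ofReal (Real.exp_pos _).le, ENNReal.toReal_ofReal (by positivity),
      ENNReal.toReal_ofReal hM0] at h2
  have hΦR : ∀ T, 0 < T → Tendsto (fun x => (Φ T x).toReal) atTop (𝓝 A) := fun T hT => by
    have := (ENNReal.tendsto_toReal ENNReal.ofReal_ne_top).comp (hlim T hT)
    rwa [ENNReal.toReal_ofReal hA] at this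
  -- The choice `T = (1 + ε⁻²)/ε` makes the tail bound exactly `ε`, leaving one parameter to send to
  -- zero.
  have hτ : ∀ ε : ℝ, 0 < ε → (1 + (ε ^ 2)⁻¹) / ((1 + (ε ^ 2)⁻¹) / ε) = ε := fun ε hε => by
    field_simp
  rw [tendsto_order]
  constructor
  · intro a ha
    have hc : Continuous fun ε : ℝ => A - ε - ε * M - Real.exp (2 * ε) * a := by fun_prop
    have h0 : ∀ᶠ ε in 𝓝[>] (0 : ℝ), 0 < A - ε - ε * M - Real.exp (2 * ε) * a :=
      (hc.tendsto 0).mono_left nhdsWithin_le_nhds |>.eventually_const_lt (by simpa using ha)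
    obtain ⟨ε, hε1, hε⟩ := (h0.and self_mem_nhdsWithin).exists
    have hε0 : 0 < ε := hε
    have hT : 0 < (1 + (ε ^ 2)⁻¹) / ε := by positivity
    have hs : Tendsto (fun x : ℝ => x - ε) atTop atTop :=
      tendsto_atTop_add_const_right _ _ tendsto_id
    filter_upwards [((hΦR _ hT).comp hs).eventually_const_lt (show A - ε < A by linarith)]
      with x hx
    have h1 := hloR _ ε hT hε0 x
    rw [hτ ε hε0] at h1
    rw [Function.comp_apply] at hx
    have h2 : Real.exp (2 * ε) * a < Real.exp (2 * ε) * (b x).toReal := by linarith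
    exact lt_of_mul_lt_mul_left h2 (Real.exp_pos _).le
  · intro a ha
    have hc : Continuous fun ε : ℝ => (1 - ε) * a - Real.exp (2 * ε) * (A + ε) := by fun_prop
    have h0 : ∀ᶠ ε in 𝓝[>] (0 : ℝ), 0 < (1 - ε) * a - Real.exp (2 * ε) * (A + ε) :=
      (hc.tendsto 0).mono_left nhdsWithin_le_nhds |>.eventually_const_lt (by simpa using ha)
    have h01 : ∀ᶠ ε in 𝓝[>] (0 : ℝ), ε < 1 := nhdsWithin_le_nhds (Iio_mem_nhds one_pos)
    obtain ⟨ε, ⟨hε1, hε2⟩, hε⟩ := ((h0.and h01).and self_mem_nhdsWithin).exists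
    have hε0 : 0 < ε := hε
    have hT : 0 < (1 + (ε ^ 2)⁻¹) / ε := by positivity
    have hs : Tendsto (fun x : ℝ => x + ε) atTop atTop :=
      tendsto_atTop_add_const_right _ _ tendsto_id
    filter_upwards [((hΦR _ hT).comp hs).eventually_lt_const (show A < A + ε by linarith)]
      with x hx
    have h1 := hupR _ ε hT hε0 x
    rw [hτ ε hε0] at h1
    rw [Function.comp_apply] at hx
    have h2 : Real.exp (2 * ε) * (Φ ((1 + (ε ^ 2)⁻¹) / ε) (x + ε)).toReal ≤
        Real.exp (2 * ε) * (A + ε) := by gcongr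
    have h3 : (1 - ε) * (b x).toReal < (1 - ε) * a := by linarith
    exact lt_of_mul_lt_mul_left h3 (by linarith)

end Tauberian

/-! ### Recovering the density from the smoothed averages. -/

section Density

/-- The kernel `e^{-v}` on `[0, ∞)`. -/
noncomputable def expKernel (v : ℝ) : ℝ≥0∞ :=
  (Set.Ici (0 : ℝ)).indicator (fun v => ENNReal.ofReal (Real.exp (-v))) v

theorem measurable_expKernel : Measurable expKernel :=
  Measurable.indicator (by fun_prop) measurableSet_Ici

theorem lintegral_expKernel : ∫⁻ v, expKernel v = 1 := by
  unfold expKernel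
  have hi : IntegrableOn (fun x : ℝ => Real.exp (-x)) (Set.Ioi 0) := by
    simpa using exp_neg_integrableOn_Ioi 0 one_pos
  rw [lintegral_indicator measurableSet_Ici, setLIntegral_congr Ioi_ae_eq_Ici.symm,
    ← ofReal_integral_eq_lintegral_ofReal hi (Eventually.of_forall fun _ => (Real.exp_pos _).le),
    integral_exp_neg_Ioi_zero, ENNReal.ofReal_one]

theorem expKernel_le {u : ℝ} (hu : 0 ≤ u) (v : ℝ) :
    expKernel v ≤ ENNReal.ofReal (Real.exp u) * expKernel (v + u) := by
  unfold expKernel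
  by_cases hv : 0 ≤ v
  · rw [Set.indicator_of_mem (Set.mem_Ici.2 hv), Set.indicator_of_mem
      (Set.mem_Ici.2 (add_nonneg hv hu)), ← ENNReal.ofReal_mul (Real.exp_pos _).le, ← Real.exp_add]
    ring_nf
    exact le_rfl
  · rw [Set.indicator_of_notMem (by simpa using hv)]
    exact zero_le

variable (K : Set ℕ)

/-- The average `∑ w_i e^{-(x - ξ_i)}` over the frequencies `ξ_i ≤ x`. -/
noncomputable def expAverage (x : ℝ) : ℝ≥0∞ :=
  ∑' i, ENNReal.ofReal (zetaWeight K i) * expKernel (x - zetaFreq i)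

theorem measurable_expAverage : Measurable (expAverage K) :=
  Measurable.tsum fun _ => (measurable_expKernel.comp (by fun_prop)).const_mul _

theorem expAverage_le (x u : ℝ) (hu : 0 ≤ u) :
    expAverage K x ≤ ENNReal.ofReal (Real.exp u) * expAverage K (x + u) := by
  unfold expAverage
  rw [← ENNReal.tsum_mul_left]
  refine ENNReal.tsum_le_tsum fun i => ?_
  rw [mul_left_comm]
  gcongr
  have := expKernel_le hu (x - zetaFreq i)
  rwa [show x - zetaFreq i + u = x + u - zetaFreq i by ring] at this

/-- Both sides convolve the frequency measure with the Fejér kernel and with `e^{-v}`; Tonelli and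
the reflection `v = x - ξ_i - u` exchange the order. -/
theorem lintegral_fejer_mul_expAverage {T : ℝ} (hT : 0 < T) (x : ℝ) :
    ∫⁻ u, ENNReal.ofReal (fejer T u) * expAverage K (x - u) =
      ∫⁻ v, expKernel v * ENNReal.ofReal
        ((inner ℂ (expL2 T (x - v)) (kZetaOperator K T (expL2 T (x - v)))).re / (2 * T)) := by
  have hfm : Measurable fun u => ENNReal.ofReal (fejer T u) :=
    (ENNReal.continuous_ofReal.comp (continuous_fejer T)).measurable
  have hk := measurable_expKernel
  have e : ∀ v, expKernel v * ENNReal.ofReal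
        ((inner ℂ (expL2 T (x - v)) (kZetaOperator K T (expL2 T (x - v)))).re / (2 * T)) =
      ∑' i, ENNReal.ofReal (zetaWeight K i) *
        (expKernel v * ENNReal.ofReal (fejer T (x - zetaFreq i - v))) := fun v => by
    rw [← (hasSum_fejerAverage K hT (x - v)).tsum_eq, ENNReal.ofReal_tsum_of_nonneg
      (fun i => mul_nonneg (zetaWeight_nonneg K i) (fejer_nonneg hT _))
      (hasSum_fejerAverage K hT (x - v)).summable, ← ENNReal.tsum_mul_left]
    refine tsum_congr fun i => ?_
    rw [ENNReal.ofReal_mul (zetaWeight_nonneg K i), mul_left_comm,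
      show x - v - zetaFreq i = x - zetaFreq i - v by ring]
  have e' : ∀ u, ENNReal.ofReal (fejer T u) * expAverage K (x - u) =
      ∑' i, ENNReal.ofReal (zetaWeight K i) *
        (expKernel (x - zetaFreq i - u) * ENNReal.ofReal (fejer T u)) := fun u => by
    rw [expAverage, ← ENNReal.tsum_mul_left]
    refine tsum_congr fun i => ?_
    rw [mul_left_comm, mul_comm (expKernel _),
      show x - u - zetaFreq i = x - zetaFreq i - u by ring]
  have hm1 : ∀ a : ℝ, Measurable fun v => expKernel v * ENNReal.ofReal (fejer T (a - v)) :=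
    fun a => hk.mul (hfm.comp (measurable_const.sub measurable_id))
  have hm2 : ∀ a : ℝ, Measurable fun u => expKernel (a - u) * ENNReal.ofReal (fejer T u) :=
    fun a => (hk.comp (measurable_const.sub measurable_id)).mul hfm
  simp only [e, e']
  rw [lintegral_tsum fun i => ((hm1 _).const_mul _).aemeasurable,
    lintegral_tsum fun i => ((hm2 _).const_mul _).aemeasurable]
  refine tsum_congr fun i => ?_
  rw [lintegral_const_mul _ (hm1 _), lintegral_const_mul _ (hm2 _)]
  congr 1
  rw [← lintegral_sub_left_eq_self (fun v => expKernel v * ENNReal.ofReal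
    (fejer T (x - zetaFreq i - v))) (x - zetaFreq i)]
  refine lintegral_congr fun u => ?_
  rw [sub_sub_cancel]

/-- Fejér averages tending to `A` still do so after averaging with the probability density `e^{-v}`,
by dominated convergence; the Tauberian theorem then removes the Fejér kernel. -/
theorem tendsto_expAverage {A : ℝ} (hA : 0 ≤ A) (hc : ∀ T : ℝ, 0 < T →
      IsCompactOperator (kZetaOperator K T - (A : ℂ) • ContinuousLinearMap.id ℂ (L2Sym T))) :
    Tendsto (fun x => (expAverage K x).toReal) atTop (𝓝 A) := by
  refine tendsto_of_tendsto_fejerAverage (measurable_expAverage K) (expAverage_le K) hA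
    (fun T hT => ⟨‖kZetaOperator K T‖, fun x => ?_⟩) fun T hT => ?_
  · rw [lintegral_fejer_mul_expAverage K hT]
    calc _ ≤ ∫⁻ v, expKernel v * ENNReal.ofReal ‖kZetaOperator K T‖ := by
          refine lintegral_mono fun v => ?_
          gcongr
          exact fejerAverage_le K hT _
      _ = _ := by rw [lintegral_mul_const _ measurable_expKernel, lintegral_expKernel, one_mul]
  · simp only [lintegral_fejer_mul_expAverage K hT]
    have h : ∫⁻ v, expKernel v * ENNReal.ofReal A = ENNReal.ofReal A := by
      rw [lintegral_mul_const _ measurable_expKernel, lintegral_expKernel, one_mul]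
    rw [← h]
    have hfm : Measurable fun y => ENNReal.ofReal
        ((inner ℂ (expL2 T y) (kZetaOperator K T (expL2 T y))).re / (2 * T)) := by
      have e : (fun y => ENNReal.ofReal
          ((inner ℂ (expL2 T y) (kZetaOperator K T (expL2 T y))).re / (2 * T))) =
          fun y => ∑' i, ENNReal.ofReal (zetaWeight K i * fejer T (y - zetaFreq i)) := by
        ext y
        rw [← (hasSum_fejerAverage K hT y).tsum_eq, ENNReal.ofReal_tsum_of_nonneg
          (fun i => mul_nonneg (zetaWeight_nonneg K i) (fejer_nonneg hT _))
          (hasSum_fejerAverage K hT y).summable]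
      rw [e]
      refine Measurable.tsum fun i => (ENNReal.continuous_ofReal.comp ?_).measurable
      have := continuous_fejer T
      fun_prop
    refine tendsto_lintegral_filter_of_dominated_convergence
      (fun v => expKernel v * ENNReal.ofReal ‖kZetaOperator K T‖)
      (Eventually.of_forall fun x => measurable_expKernel.mul
        (hfm.comp (measurable_const.sub measurable_id)))
      (Eventually.of_forall fun x => Eventually.of_forall fun v => ?_) ?_
      (Eventually.of_forall fun v => ?_)
    · gcongr
      exact fejerAverage_le K hT _
    · rw [lintegral_mul_const _ measurable_expKernel, lintegral_expKernel, one_mul]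
      exact ENNReal.ofReal_ne_top
    · refine ENNReal.Tendsto.const_mul ?_ (Or.inr ?_)
      · have hs : Tendsto (fun x : ℝ => x - v) atTop atTop :=
          tendsto_atTop_add_const_right _ _ tendsto_id
        exact ENNReal.tendsto_ofReal ((tendsto_fejerAverage K hT (hc T hT)).comp hs)
      · unfold expKernel
        by_cases hv : v ∈ Set.Ici (0 : ℝ)
        · rw [Set.indicator_of_mem hv]
          exact ENNReal.ofReal_ne_top
        · rw [Set.indicator_of_notMem hv]
          exact ENNReal.zero_ne_top

/-- For a frequency `log n ≤ x` the weight `1/n` cancels against `e^{log n}`, so each `n ∈ K`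
contributes `e^{-x}` and the total counts `n ≤ e^x`. The frequencies `-log n` all lie below `x ≥ 0`
and contribute `e^{-x}` times a convergent series. -/
theorem expAverage_eq {x : ℝ} (hx : 0 ≤ x) :
    expAverage K x = ENNReal.ofReal (kCount K (Real.exp x) / Real.exp x) +
      ENNReal.ofReal (Real.exp (-x) * ∑' n : ℕ, recipWeight K n * (n : ℝ) ^ (-1 : ℝ)) := by
  unfold expAverage
  rw [ENNReal.summable.tsum_sum ENNReal.summable]
  congr 1
  · have h1 : ∀ n ∉ Finset.Icc 0 ⌊Real.exp x⌋₊, ENNReal.ofReal (zetaWeight K (.inl n)) *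
        expKernel (x - zetaFreq (.inl n)) = 0 := fun n hn => by
      have hn' : Real.exp x < n := by
        simpa [Nat.floor_lt (Real.exp_pos x).le] using hn
      have : x < Real.log n :=
        (Real.lt_log_iff_exp_lt ((Real.exp_pos x).trans hn')).2 hn'
      have h2 : x - zetaFreq (.inl n) ∉ Set.Ici (0 : ℝ) := by
        simpa [zetaFreq] using this
      rw [expKernel, Set.indicator_of_notMem h2, mul_zero]
    rw [tsum_eq_sum h1, kCount_eq_sum K (Real.exp_pos x).le, Finset.sum_div,
      ENNReal.ofReal_sum_of_nonneg fun n _ =>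
        div_nonneg (Set.indicator_nonneg (fun _ _ => zero_le_one) _) (Real.exp_pos x).le]
    refine Finset.sum_congr rfl fun n hn => ?_
    rcases eq_or_ne n 0 with rfl | hn0
    · simp [zetaWeight]
    have hn1 : (0 : ℝ) < n := by positivity
    have hn' : (n : ℝ) ≤ Real.exp x :=
      (Nat.le_floor_iff (Real.exp_pos x).le).1 (Finset.mem_Icc.1 hn).2
    have h2 : x - zetaFreq (.inl n) ∈ Set.Ici (0 : ℝ) := by
      have := (Real.log_le_iff_le_exp hn1).2 hn'
      simpa [zetaFreq] using this
    rw [expKernel, Set.indicator_of_mem h2, ← ENNReal.ofReal_mul (zetaWeight_nonneg K _)]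
    congr 1
    simp only [zetaWeight, zetaFreq, Sum.elim_inl, neg_sub, Real.exp_sub, Real.exp_log hn1]
    by_cases hK : n ∈ K
    · simp only [recipWeight, Set.indicator_of_mem hK,
        Set.indicator_of_mem (show n ∈ K \ {0} from ⟨hK, hn0⟩)]
      field_simp
    · simp [recipWeight, hK]
  · rw [← tsum_mul_left, ENNReal.ofReal_tsum_of_nonneg
      (fun n => mul_nonneg (Real.exp_pos _).le
        (mul_nonneg (recipWeight_nonneg K n) (by positivity)))
      ((summable_recipWeight_mul_rpow K one_pos).mul_left _)]
    refine tsum_congr fun n => ?_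
    rcases eq_or_ne n 0 with rfl | hn0
    · simp [zetaWeight]
    have hn1 : (0 : ℝ) < n := by positivity
    have h2 : x - zetaFreq (.inr n) ∈ Set.Ici (0 : ℝ) := by
      have := Real.log_natCast_nonneg n
      simp only [zetaFreq, Sum.elim_inr, Set.mem_Ici]
      linarith
    rw [expKernel, Set.indicator_of_mem h2, ← ENNReal.ofReal_mul (zetaWeight_nonneg K _)]
    congr 1
    simp only [zetaWeight, zetaFreq, Sum.elim_inr]
    rw [Real.rpow_neg_one, show -(x - -Real.log n) = -x - Real.log n by ring, Real.exp_sub,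
      Real.exp_log hn1]
    ring

theorem density_of_isCompactOperator {A : ℝ} (hA : 0 ≤ A) (hc : ∀ T : ℝ, 0 < T →
      IsCompactOperator (kZetaOperator K T - (A : ℂ) • ContinuousLinearMap.id ℂ (L2Sym T))) :
    Tendsto (fun x : ℝ => (kCount K x : ℝ) / x) atTop (𝓝 A) := by
  set c := ∑' n : ℕ, recipWeight K n * (n : ℝ) ^ (-1 : ℝ) with hc'
  have hc0 : 0 ≤ c := tsum_nonneg fun n => mul_nonneg (recipWeight_nonneg K n) (by positivity)
  have h1 : Tendsto (fun x : ℝ => Real.exp (-x) * c) atTop (𝓝 0) := by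
    simpa using (Real.tendsto_exp_neg_atTop_nhds_zero).mul_const c
  have h2 := (tendsto_expAverage K hA hc).sub h1
  rw [sub_zero] at h2
  have h3 : Tendsto (fun x : ℝ => (kCount K (Real.exp x) : ℝ) / Real.exp x) atTop (𝓝 A) := by
    refine h2.congr' ?_
    filter_upwards [eventually_ge_atTop 0] with x hx
    rw [expAverage_eq K hx, ENNReal.toReal_add ENNReal.ofReal_ne_top ENNReal.ofReal_ne_top,
      ENNReal.toReal_ofReal (by positivity), ENNReal.toReal_ofReal (by positivity)]
    ring
  refine (h3.comp Real.tendsto_log_atTop).congr' ?_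
  filter_upwards [eventually_gt_atTop 0] with x hx
  rw [Function.comp_apply, Real.exp_log hx]

end Density

/-- The first conjunct says that the limit defining `𝒵_{K,I}` exists (in `L²(I)`, for each `g`)
and is a bounded operator for every `I = (-T, T)`; the second is the identity theorem. -/
theorem theorem3 (K : Set ℕ) (A : ℝ) (hA : 0 ≤ A) :
    (∀ T : ℝ, 0 < T → IsKZetaOperator K T (kZetaOperator K T)) ∧
    ((∀ T : ℝ, 0 < T →
        IsCompactOperator
          (kZetaOperator K T - (A : ℂ) • ContinuousLinearMap.id ℂ (L2Sym T))) ↔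
      Tendsto (fun x : ℝ => (kCount K x : ℝ) / x) atTop (𝓝 A)) :=
  ⟨fun _ hT => isKZetaOperator_kZetaOperator K hT,
    fun h => density_of_isCompactOperator K hA h,
    fun h _ hT => isCompactOperator_of_density K h hT⟩
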